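/- Let $\mathbb{H}$ be the quaternions and regard $V=\mathbb{H}^n$ (columns) as a right $\mathbb{H}$-vector space with the skew-Hermitian form $\langle v,u\rangle=\bar v^{\,t}\,\mathbf{j}\,u$. Put $$\mathrm{SO}^*(2n)=\{g\in \mathrm{SL}_n(\mathbb{H})\mid \bar g^{\,t}\,\mathbf{j}I_n\, g=\mathbf{j}I_n\},\qquad \mathfrak{so}^*(2n)=\{Z\in\mathfrak{sl}_n(\mathbb{H})\mid \bar Z^{\,t}\,\mathbf{j}I_n+\mathbf{j}I_n Z=0\},$$ $$\mathrm{Sp}(p,q)=\{g\in \mathrm{SL}_{p+q}(\mathbb{H})\mid \bar g^{\,t} I_{p,q}\, g=I_{p,q}\},$$ where $\mathrm{SL}_m(\mathbb{H})$ (respectively $\mathfrak{sl}_m(\mathbb{H})$) consists of the matrices of reduced norm $1$ (respectively reduced trace $0$) and $I_{p,q}=\mathrm{diag}(I_p,-I_q)$. For an $\mathfrak{sl}_2(\mathbb{R})$-triple $\{X,H,Y\}\subset\mathfrak{so}^*(2n)$ (so $X\neq 0$, $[H,X]=2X$, $[H,Y]=-2Y$, $[X,Y]=H$) and $d\ge 1$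 let $L(d-1)=\{v\in V\mid Yv=0,\ Hv=(1-d)v\}$, with the form $(v,u)_d=\langle v,X^{d-1}u\rangle$, which is Hermitian for even $d$ and skew-Hermitian for odd $d$. A signed Young diagram of size $n$ is a partition $\mathbf d$ of $n$, in which $d$ has multiplicity $t_d$, together with, for each part $d$, a $t_d\times d$ matrix of signs $(m^d_{ij})$ whose first column consists of some $+1$'s followed by $-1$'s and in which $m^d_{ij}=(-1)^{j+1}m^d_{i1}$, except that $m^d_{id}=-m^d_{i1}$ if $d\equiv 3 \pmod 4$. The adjoint orbit $\mathcal{O}_X$ under $\mathrm{SO}^*(2n)$ of a nonzero nilpotent $X\in\mathfrak{so}^*(2n)$ corresponds to the signed Young diagram for which, for an $\mathfrak{sl}_2(\mathbb{R})$-triple $\{X',H',Y'\}$ with $X'\in\mathcal{O}_X$: $t_d=\dim_{\mathbb{H}}L(d-1)$ for all $d\ge1$; the first column of the block of each odd part consists of $+1$'s; and for each even part $\eta$ the numbers $p_\eta$ of $+1$'s and $q_\eta$ of $-1$'s in the first column of the $t_\eta\times\eta$ block form the signature $(p_\eta,q_\eta)$ of $(\cdot,\cdot)_\eta$ on $L(\eta-1)$.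 **Proposition.** Let $X\in\mathfrak{so}^*(2n)$ be a nonzero nilpotent element and $\{X,H,Y\}$ an $\mathfrak{sl}_2(\mathbb{R})$-triple in $\mathfrak{so}^*(2n)$. Suppose that $\mathcal{O}_X$ corresponds to a signed Young diagram of size $n$ with partition $\mathbf d$, and let $\mathbb{O}_{\mathbf d}$ and $\mathbb{E}_{\mathbf d}$ be the sets of its odd and even parts. Then the centralizer $\mathcal{Z}_{\mathrm{SO}^*(2n)}(X,H,Y)=\{g\in\mathrm{SO}^*(2n)\mid \mathrm{Ad}(g)Z=Z \text{ for } Z=X,H,Y\}$ satisfies $$\mathcal{Z}_{\mathrm{SO}^*(2n)}(X,H,Y)\;\simeq\;\prod_{\theta\in\mathbb{O}_{\mathbf d}}\mathrm{SO}^*(2t_\theta)\times\prod_{\eta\in\mathbb{E}_{\mathbf d}}\mathrm{Sp}(p_\eta,q_\eta)$$ as Lie groups (equivalently, since these are closed linear groups, as topological groups). -/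

import Mathlib

open scoped Quaternion Matrix

attribute [local instance] LieRing.ofAssociativeRing

noncomputable section

/-! ### Quaternionic matrices, reduced norm and reduced trace -/

/-- Square matrices over Hamilton's quaternions. -/
abbrev HMat (ι : Type) : Type := Matrix ι ι ℍ[ℝ]

/-- The quaternion unit `j`. -/
def quatJ : ℍ[ℝ] := ⟨0, 0, 1, 0⟩

/-- Writing `q = z + w j` with `z, w` complex, this is `z`. -/
def quatFst (q : ℍ[ℝ]) : ℂ := ⟨q.re, q.imI⟩

/-- Writing `q = z + w j` with `z, w` complex, this is `w`. -/
def quatSnd (q : ℍ[ℝ]) : ℂ := ⟨q.imJ, q.imK⟩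

theorem quatFst_add (a b : ℍ[ℝ]) : quatFst (a + b) = quatFst a + quatFst b := by
  apply Complex.ext <;> simp [quatFst]

theorem quatSnd_add (a b : ℍ[ℝ]) : quatSnd (a + b) = quatSnd a + quatSnd b := by
  apply Complex.ext <;> simp [quatSnd]

theorem quatFst_zero : quatFst 0 = 0 := by
  apply Complex.ext <;> simp [quatFst]

theorem quatSnd_zero : quatSnd 0 = 0 := by
  apply Complex.ext <;> simp [quatSnd]

theorem quatFst_one : quatFst 1 = 1 := by
  apply Complex.ext <;> simp [quatFst]

theorem quatSnd_one : quatSnd 1 = 0 := by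
  apply Complex.ext <;> simp [quatSnd]

theorem quatFst_mul (a b : ℍ[ℝ]) :
    quatFst (a * b) = quatFst a * quatFst b + quatSnd a * (-star (quatSnd b)) := by
  apply Complex.ext <;> simp [quatFst, quatSnd] <;> ring

theorem quatSnd_mul (a b : ℍ[ℝ]) :
    quatSnd (a * b) = quatFst a * quatSnd b + quatSnd a * star (quatFst b) := by
  apply Complex.ext <;> simp [quatFst, quatSnd] <;> ring

theorem quatFst_sum {κ : Type} (s : Finset κ) (f : κ → ℍ[ℝ]) :
    quatFst (∑ k ∈ s, f k) = ∑ k ∈ s, quatFst (f k) :=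
  map_sum (AddMonoidHom.mk' quatFst quatFst_add) f s

theorem quatSnd_sum {κ : Type} (s : Finset κ) (f : κ → ℍ[ℝ]) :
    quatSnd (∑ k ∈ s, f k) = ∑ k ∈ s, quatSnd (f k) :=
  map_sum (AddMonoidHom.mk' quatSnd quatSnd_add) f s

/-- The standard embedding of the quaternionic matrices in the complex matrices of twice the
size: for complex matrices `A`, `B` it sends `A + B j` to `[[A, B], [-conj B, conj A]]`. -/
def complexify {ι : Type} (M : HMat ι) : Matrix (ι ⊕ ι) (ι ⊕ ι) ℂ :=
  Matrix.fromBlocks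
    (Matrix.of fun i k => quatFst (M i k)) (Matrix.of fun i k => quatSnd (M i k))
    (Matrix.of fun i k => -star (quatSnd (M i k))) (Matrix.of fun i k => star (quatFst (M i k)))

theorem complexify_one {ι : Type} [DecidableEq ι] : complexify (1 : HMat ι) = 1 := by
  ext i k
  rcases i with i | i <;> rcases k with k | k <;> by_cases h : i = k <;>
    simp [complexify, Matrix.one_apply, h, quatFst_one, quatSnd_one, quatFst_zero, quatSnd_zero]

theorem complexify_mul {ι : Type} [Fintype ι] (M N : HMat ι) :
    complexify (M * N) = complexify M * complexify N := by
  ext i k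
  rcases i with i | i <;> rcases k with k | k <;>
    simp [complexify, Matrix.mul_apply, quatFst_sum, quatSnd_sum, quatFst_mul, quatSnd_mul,
      Finset.sum_add_distrib] <;>
    ring

theorem complexify_add {ι : Type} (M N : HMat ι) :
    complexify (M + N) = complexify M + complexify N := by
  ext i k
  rcases i with i | i <;> rcases k with k | k <;>
    simp [complexify, quatFst_add, quatSnd_add] <;> ring

/-- The reduced norm of `M_ι(ℍ)` (its values are real numbers, here regarded as complex). -/
def reducedNorm {ι : Type} [Fintype ι] [DecidableEq ι] : HMat ι →* ℂ where
  toFun M := (complexify M).det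
  map_one' := by rw [complexify_one, Matrix.det_one]
  map_mul' M N := by rw [complexify_mul, Matrix.det_mul]

/-- The reduced trace of `M_ι(ℍ)` (its values are real numbers, here regarded as complex). -/
def reducedTrace {ι : Type} [Fintype ι] : HMat ι →+ ℂ :=
  AddMonoidHom.mk' (fun M => (complexify M).trace)
    (fun M N => by rw [complexify_add, Matrix.trace_add])

theorem reducedTrace_mul_comm {ι : Type} [Fintype ι] (M N : HMat ι) :
    reducedTrace (M * N) = reducedTrace (N * M) := by
  change (complexify (M * N)).trace = (complexify (N * M)).trace
  rw [complexify_mul, complexify_mul, Matrix.trace_mul_comm]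

theorem reducedTrace_smul {ι : Type} [Fintype ι] (c : ℝ) (M : HMat ι) :
    reducedTrace (c • M) = (c : ℂ) * reducedTrace M := by
  change (complexify (c • M)).trace = (c : ℂ) * (complexify M).trace
  have h : complexify (c • M) = (c : ℂ) • complexify M := by
    ext i k
    rcases i with i | i <;> rcases k with k | k <;>
      apply Complex.ext <;> simp [complexify, quatFst, quatSnd]
  rw [h, Matrix.trace_smul, smul_eq_mul]

/-! ### The classical groups over the quaternions -/

section Groups

variable (ι : Type) [Fintype ι] [DecidableEq ι]

/-- `SL_ι(ℍ)`, the invertible quaternionic matrices of reduced norm `1`. -/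
def quatSL : Subgroup (HMat ι)ˣ :=
  (Units.map (reducedNorm (ι := ι))).ker

variable {ι}

/-- The invertible matrices `g` with `gᴴ J g = J`, where `gᴴ` is the quaternionic conjugate
transpose. -/
def quatIsometry (J : HMat ι) : Subgroup (HMat ι)ˣ where
  carrier := {g | (g : HMat ι)ᴴ * J * (g : HMat ι) = J}
  one_mem' := by simp
  mul_mem' {a b} ha hb := by
    simp only [Set.mem_ofPred_eq, Units.val_mul, Matrix.conjTranspose_mul] at *
    calc (b : HMat ι)ᴴ * (a : HMat ι)ᴴ * J * ((a : HMat ι) * (b : HMat ι))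
        = (b : HMat ι)ᴴ * ((a : HMat ι)ᴴ * J * (a : HMat ι)) * (b : HMat ι) := by
          simp only [mul_assoc]
      _ = J := by rw [ha, hb]
  inv_mem' {a} ha := by
    simp only [Set.mem_ofPred_eq] at *
    have h1 : ((a⁻¹ : (HMat ι)ˣ) : HMat ι)ᴴ * (a : HMat ι)ᴴ = 1 := by
      rw [← Matrix.conjTranspose_mul, Units.mul_inv, Matrix.conjTranspose_one]
    calc ((a⁻¹ : (HMat ι)ˣ) : HMat ι)ᴴ * J * ((a⁻¹ : (HMat ι)ˣ) : HMat ι)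
        = ((a⁻¹ : (HMat ι)ˣ) : HMat ι)ᴴ * ((a : HMat ι)ᴴ * J * (a : HMat ι))
            * ((a⁻¹ : (HMat ι)ˣ) : HMat ι) := by rw [ha]
      _ = (((a⁻¹ : (HMat ι)ˣ) : HMat ι)ᴴ * (a : HMat ι)ᴴ) * J
            * ((a : HMat ι) * ((a⁻¹ : (HMat ι)ˣ) : HMat ι)) := by simp only [mul_assoc]
      _ = J := by rw [h1, Units.mul_inv, one_mul, mul_one]

/-- The Lie algebra of quaternionic matrices `Z` of reduced trace `0` with `Zᴴ J + J Z = 0`. -/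
def quatLie (J : HMat ι) : LieSubalgebra ℝ (HMat ι) where
  carrier := {Z | reducedTrace Z = 0 ∧ Zᴴ * J + J * Z = 0}
  add_mem' {a b} ha hb := by
    refine ⟨by rw [map_add, ha.1, hb.1, add_zero], ?_⟩
    rw [Matrix.conjTranspose_add, add_mul, mul_add, add_add_add_comm, ha.2, hb.2, add_zero]
  zero_mem' := by simp
  smul_mem' c Z hZ := by
    refine ⟨by rw [reducedTrace_smul, hZ.1, mul_zero], ?_⟩
    have hc : (c • Z)ᴴ = c • Zᴴ := by
      ext i k <;> simp
    rw [hc, smul_mul_assoc, mul_smul_comm, ← smul_add, hZ.2, smul_zero]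
  lie_mem' {a b} ha hb := by
    have ha' : aᴴ * J = -(J * a) := eq_neg_of_add_eq_zero_left ha.2
    have hb' : bᴴ * J = -(J * b) := eq_neg_of_add_eq_zero_left hb.2
    refine ⟨?_, ?_⟩
    · rw [Ring.lie_def, map_sub, reducedTrace_mul_comm, sub_self]
    · rw [Ring.lie_def, Matrix.conjTranspose_sub, Matrix.conjTranspose_mul,
        Matrix.conjTranspose_mul, sub_mul, mul_assoc, mul_assoc, ha', hb', mul_neg, mul_neg,
        ← mul_assoc, ← mul_assoc, ha', hb']
      noncomm_ring

end Groups

/-- The matrix `j I_n` of the standard skew-Hermitian form on `ℍ^n`. -/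
def skewMatrix (n : ℕ) : HMat (Fin n) := Matrix.diagonal fun _ => quatJ

/-- The group `SO*(2n)`, realised by quaternionic matrices of size `n`. -/
def SOStar (n : ℕ) : Subgroup (HMat (Fin n))ˣ :=
  quatSL (Fin n) ⊓ quatIsometry (skewMatrix n)

/-- The Lie algebra `so*(2n)`, realised by quaternionic matrices of size `n`. -/
def soStar (n : ℕ) : LieSubalgebra ℝ (HMat (Fin n)) :=
  quatLie (skewMatrix n)

/-- The matrix `I_{p,q}`. -/
def signatureMatrix (p q : ℕ) : HMat (Fin p ⊕ Fin q) :=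
  Matrix.diagonal (Sum.elim (fun _ => 1) (fun _ => -1))

/-- The group `Sp(p,q)`. -/
def SpPQ (p q : ℕ) : Subgroup (HMat (Fin p ⊕ Fin q))ˣ :=
  quatSL (Fin p ⊕ Fin q) ⊓ quatIsometry (signatureMatrix p q)

/-- The centralizer `{g ∈ G | Ad(g) Z = Z for all Z ∈ S}` in `G` of a set `S` of matrices. -/
def adCentralizer {ι : Type} [Fintype ι] [DecidableEq ι] (G : Subgroup (HMat ι)ˣ)
    (S : Set (HMat ι)) : Subgroup (HMat ι)ˣ where
  carrier := {g | g ∈ G ∧ ∀ Z ∈ S, (g : HMat ι) * Z * ((g⁻¹ : (HMat ι)ˣ) : HMat ι) = Z}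
  one_mem' := ⟨G.one_mem, by simp⟩
  mul_mem' {a b} ha hb := by
    refine ⟨G.mul_mem ha.1 hb.1, fun Z hZ => ?_⟩
    rw [mul_inv_rev, Units.val_mul, Units.val_mul]
    calc (a : HMat ι) * (b : HMat ι) * Z
          * (((b⁻¹ : (HMat ι)ˣ) : HMat ι) * ((a⁻¹ : (HMat ι)ˣ) : HMat ι))
        = (a : HMat ι) * ((b : HMat ι) * Z * ((b⁻¹ : (HMat ι)ˣ) : HMat ι))
          * ((a⁻¹ : (HMat ι)ˣ) : HMat ι) := by simp only [mul_assoc]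
      _ = Z := by rw [hb.2 Z hZ, ha.2 Z hZ]
  inv_mem' {a} ha := by
    refine ⟨G.inv_mem ha.1, fun Z hZ => ?_⟩
    rw [inv_inv]
    calc ((a⁻¹ : (HMat ι)ˣ) : HMat ι) * Z * (a : HMat ι)
        = ((a⁻¹ : (HMat ι)ˣ) : HMat ι)
          * ((a : HMat ι) * Z * ((a⁻¹ : (HMat ι)ˣ) : HMat ι)) * (a : HMat ι) := by
          rw [ha.2 Z hZ]
      _ = (((a⁻¹ : (HMat ι)ˣ) : HMat ι) * (a : HMat ι)) * Z
          * (((a⁻¹ : (HMat ι)ˣ) : HMat ι) * (a : HMat ι)) := by simp only [mul_assoc]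
      _ = Z := by rw [Units.inv_mul, one_mul, mul_one]

/-! ### The spaces of lowest weight vectors and their forms

The column space `ℍ^n` is a right vector space over `ℍ`, that is, a module over the opposite
ring `ℍᵐᵒᵖ`; quaternionic matrices act on it on the left. -/

/-- The standard skew-Hermitian form `⟨v, u⟩ = conj(v)ᵗ (j I_n) u` on `ℍ^n`. -/
def skewForm {n : ℕ} (v u : Fin n → ℍ[ℝ]) : ℍ[ℝ] :=
  star v ⬝ᵥ (skewMatrix n *ᵥ u)

/-- The right `ℍ`-subspace `L(d-1) = {v | Y v = 0, H v = (1 - d) v}` of the lowest weight vectors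
of the `d`-dimensional irreducible constituents of `ℍ^n`. -/
def lowestWeightSpace {n : ℕ} (H Y : HMat (Fin n)) (d : ℕ) :
    Submodule ℍ[ℝ]ᵐᵒᵖ (Fin n → ℍ[ℝ]) where
  carrier := {v | Y *ᵥ v = 0 ∧ H *ᵥ v = (1 - (d : ℝ)) • v}
  add_mem' {v u} hv hu :=
    ⟨by rw [Matrix.mulVec_add, hv.1, hu.1, add_zero],
      by rw [Matrix.mulVec_add, hv.2, hu.2, smul_add]⟩
  zero_mem' := by simp
  smul_mem' a v hv :=
    ⟨by rw [Matrix.mulVec_smul, hv.1, smul_zero],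
      by rw [Matrix.mulVec_smul, hv.2, smul_comm]⟩

/-- The form `(v, u)_d = ⟨v, X^(d-1) u⟩` on `L(d-1)`, for `d ≥ 1`. -/
def lowestWeightForm {n : ℕ} (X H Y : HMat (Fin n)) (d : ℕ)
    (v u : lowestWeightSpace H Y d) : ℍ[ℝ] :=
  skewForm (v : Fin n → ℍ[ℝ]) ((X ^ (d - 1)) *ᵥ (u : Fin n → ℍ[ℝ]))

/-- A form on a right `ℍ`-vector space has signature `(p, q)`: there is an orthogonal basis of
`p` vectors with `B v v = 1` and `q` vectors with `B v v = -1`. -/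
def HasSignature {V : Type} [AddCommGroup V] [Module ℍ[ℝ]ᵐᵒᵖ V] (B : V → V → ℍ[ℝ])
    (p q : ℕ) : Prop :=
  ∃ b : Module.Basis (Fin p ⊕ Fin q) ℍ[ℝ]ᵐᵒᵖ V,
    (∀ r s, r ≠ s → B (b r) (b s) = 0) ∧
    (∀ r, B (b (Sum.inl r)) (b (Sum.inl r)) = 1) ∧
    (∀ r, B (b (Sum.inr r)) (b (Sum.inr r)) = -1)

/-! ### Signed Young diagrams -/

/-- The block of the rows of length `d` of a signed Young diagram, `t` in number: in the first
column there are some `+1`s and below them only `-1`s; along each row the signs alternate, except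
that for `d ≡ 3 (mod 4)` the last sign is opposite to the first. -/
def IsSignBlock {t d : ℕ} (m : Matrix (Fin t) (Fin d) ℤˣ) : Prop :=
  ∃ c : Fin t → ℤˣ,
    (∃ p ≤ t, ∀ i, c i = if (i : ℕ) < p then 1 else -1) ∧
    ∀ i (k : Fin d), m i k =
      if d % 4 = 3 ∧ (k : ℕ) + 1 = d then -c i else (-1) ^ (k : ℕ) * c i

/-- Signed Young diagrams of size `n` (in normal form): a partition of `n`, together with a block
of signs for the rows of length `d`, for each `d`. -/
structure SignedYoungDiagram (n : ℕ) where
  part : Nat.Partition n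
  sgn : ∀ d : ℕ, Matrix (Fin (part.parts.count d)) (Fin d) ℤˣ
  isSignBlock : ∀ d, IsSignBlock (sgn d)

namespace SignedYoungDiagram

variable {n : ℕ} (D : SignedYoungDiagram n)

/-- The multiplicity `t_d` of `d` in the partition. -/
def mult (d : ℕ) : ℕ := D.part.parts.count d

/-- The number of signs `s` in the first column of the block of size `t_d × d`. -/
def firstColumnCount (s : ℤˣ) (d : ℕ) : ℕ :=
  Nat.card {i : Fin (D.part.parts.count d) // ∃ k : Fin d, (k : ℕ) = 0 ∧ D.sgn d i k = s}

/-- The number `p_d` of signs `+1` in the first column of the block of size `t_d × d`. -/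
def posCount (d : ℕ) : ℕ := D.firstColumnCount 1 d

/-- The number `q_d` of signs `-1` in the first column of the block of size `t_d × d`. -/
def negCount (d : ℕ) : ℕ := D.firstColumnCount (-1) d

/-- The set of the odd parts of the partition. -/
def oddParts : Set ℕ := {θ | θ ∈ D.part.parts ∧ Odd θ}

/-- The set of the even parts of the partition. -/
def evenParts : Set ℕ := {η | η ∈ D.part.parts ∧ Even η}

end SignedYoungDiagram

/-- The adjoint orbit of `X` under `SO*(2n)`. -/
def adOrbit {n : ℕ} (X : soStar n) : Set (soStar n) :=
  {X' | ∃ g ∈ SOStar n, (X' : HMat (Fin n)) =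
    (g : HMat (Fin n)) * (X : HMat (Fin n)) * ((g⁻¹ : (HMat (Fin n))ˣ) : HMat (Fin n))}

/-- The nilpotent orbit of `X ≠ 0` in `so*(2n)` corresponds to the signed Young diagram `D`: for
an `sl₂`-triple whose nilpositive element lies in the orbit, `t_d = dim L(d-1)` for all `d ≥ 1`,
the first column of each odd block has only signs `+1`, and the form on `L(η-1)` has signature
`(p_η, q_η)` for each even part `η`. -/
def OrbitCorrespondsTo {n : ℕ} (X : soStar n) (D : SignedYoungDiagram n) : Prop :=
  ∃ X' H' Y' : soStar n, X' ∈ adOrbit X ∧ IsSl2Triple H' X' Y' ∧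
    (∀ d : ℕ, 1 ≤ d → D.mult d =
      Module.finrank ℍ[ℝ]ᵐᵒᵖ
        (lowestWeightSpace (H' : HMat (Fin n)) (Y' : HMat (Fin n)) d)) ∧
    (∀ θ ∈ D.oddParts, D.posCount θ = D.mult θ) ∧
    (∀ η ∈ D.evenParts,
      HasSignature (lowestWeightForm (X' : HMat (Fin n)) (H' : HMat (Fin n)) (Y' : HMat (Fin n)) η)
        (D.posCount η) (D.negCount η))

end

/-! Through the triple, V = ℍⁿ is a representation of sl₂(ℝ) commuting with the right action of ℍ.
It is the direct sum of the spaces X^k L(d-1), 0 ≤ k < d. An element commuting with X, H, Y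
preserves each L(d-1) and is determined by its restrictions there, because it commutes with X^k;
conversely, any family of ℍ-linear automorphisms of the L(d-1) extends along the strings. Since H is
skew for the form, X^k L(d-1) and X^k' L(d'-1) are orthogonal unless d = d' and k + k' = d - 1, and
then the pairing is (-1)^k times (·,·)_d. So the extension is an isometry exactly when every
restriction preserves (·,·)_d (`assemble_isometry_iff`), and the centralizer is the product of the
isometry groups of these forms (`centralizerEquiv`). For even d the signature turns the factor into
Sp(p,q). For odd d the form is nondegenerate and skew-Hermitian, so it has a basis with Gram matrix
j (`IsSkewHermitian.exists_basis`), and the factor is SO*(2t).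

Three further points carry the argument. The diagram describes some triple through the orbit, not
the given one; but L(d-1) with its form is isometric to a subquotient of V defined by X alone
(`exists_isometry_lowestWeightSpace`). Reduced norm 1 is automatic for isometries of an invertible
form, because reduced norms are nonnegative (`mem_quatSL_of_isometry`). Finally, both directions of
the isomorphism are matrix multiplications by a fixed change of basis and selections of blocks,
hence continuous.

The sl₂-theory is done over ℝ and rests on ker y ∩ range x = 0 (`eq_zero_of_mem_range`). -/

noncomputable section

/-! ### Finite-dimensional representations of `sl₂` over the reals -/

section Sl2

open Module Polynomial

variable {V : Type} [AddCommGroup V] [Module ℝ V]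

/-- Elements `x, h, y` of a ring satisfying the relations of `sl₂`. -/
structure Sl2Rel {A : Type} [Ring A] (x h y : A) : Prop where
  xy : x * y - y * x = h
  hx : h * x = x * h + 2 * x
  hy : h * y = y * h - 2 * y

namespace Sl2Rel

theorem map {A B : Type} [Ring A] [Ring B] {x h y : A} (r : Sl2Rel x h y) (f : A →+* B) :
    Sl2Rel (f x) (f h) (f y) where
  xy := by rw [← map_mul, ← map_mul, ← map_sub, r.xy]
  hx := by rw [← map_mul, r.hx, map_add, map_mul, map_mul, map_ofNat]
  hy := by rw [← map_mul, r.hy, map_sub, map_mul, map_mul, map_ofNat]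

variable {x h y : End ℝ V}

theorem swap (r : Sl2Rel x h y) : Sl2Rel y (-h) x where
  xy := by rw [← r.xy]; abel
  hx := by rw [neg_mul, r.hy]; noncomm_ring
  hy := by rw [neg_mul, r.hx]; noncomm_ring

theorem h_mul_x_pow (r : Sl2Rel x h y) (k : ℕ) : h * x ^ k = x ^ k * h + (2 * k : ℝ) • x ^ k := by
  induction k with
  | zero => simp
  | succ k ih =>
    rw [pow_succ, ← mul_assoc, ih, add_mul, mul_assoc, r.hx, smul_mul_assoc, mul_add, two_mul,
      mul_add]
    push_cast
    rw [mul_add, add_smul, mul_one, two_smul, ← mul_assoc]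
    abel

theorem y_mul_x_pow (r : Sl2Rel x h y) (k : ℕ) :
    y * x ^ (k + 1) = x ^ (k + 1) * y - ((k : ℝ) + 1) • (x ^ k * (h + (k : ℝ) • 1)) := by
  induction k with
  | zero => simp [← r.xy]
  | succ k ih =>
    have hyx : y * x = x * y - h := by rw [← r.xy]; abel
    rw [pow_succ' x (k + 1), ← mul_assoc, hyx, sub_mul, mul_assoc, ih, r.h_mul_x_pow]
    push_cast
    rw [mul_sub, mul_smul_comm, ← mul_assoc, ← mul_assoc, ← pow_succ' x k, ← pow_succ' x (k + 1)]
    simp only [mul_add, mul_smul_comm, mul_one]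
    module

/-- Every nonzero x^k is an eigenvector of ad h with eigenvalue 2k, and a finite-dimensional space
has no room for infinitely many distinct eigenvalues. -/
theorem x_nilpotent [FiniteDimensional ℝ V] (r : Sl2Rel x h y) : IsNilpotent x := by
  by_contra hx
  have hne : ∀ k : ℕ, x ^ k ≠ 0 := fun k hk => hx ⟨k, hk⟩
  let A : End ℝ (End ℝ V) := LinearMap.mulLeft ℝ h - LinearMap.mulRight ℝ h
  have hev : ∀ k : ℕ, A.HasEigenvector (2 * k : ℝ) (x ^ k) := fun k => by
    refine ⟨?_, hne k⟩
    rw [Module.End.mem_eigenspace_iff]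
    simp [A, r.h_mul_x_pow]
  have := Module.End.eigenvectors_linearIndependent' A (fun k : ℕ => (2 * k : ℝ))
    (fun a b hab => by simpa using hab) (fun k => x ^ k) hev
  have := this.finite_of_isNoetherian
  exact not_finite ℕ

/-- `falling k = t (t - 1) ⋯ (t - k + 1)`. -/
def falling (k : ℕ) : ℝ[X] := ∏ i ∈ Finset.range k, (X - C (i : ℝ))

/-- The hypothesis is weaker than x w = 0, but it suffices: only y^(k+1) x w has to vanish, and ker
(y x) is stable under h. With y nilpotent this bounds the weights of w from below by 0. -/
theorem x_pow_y_pow (r : Sl2Rel x h y) (k : ℕ) (w : V) (hw : y (x w) = 0) :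
    (x ^ k) ((y ^ k) w) = (k.factorial : ℝ) • aeval h (falling k) w := by
  induction k generalizing w with
  | zero => simp [falling]
  | succ k ih =>
    have h1 := congr($(r.swap.y_mul_x_pow k) w)
    have hcomm : y (x (h w)) = 0 := by
      have e : y * x * h = h * (y * x) := by
        rw [← mul_assoc, r.hy, sub_mul, mul_assoc y h x, r.hx]
        noncomm_ring
      have := congr($e w)
      simpa [hw] using this
    have h2 : y (x ((h - (k : ℝ) • 1) w)) = 0 := by simp [hcomm, hw]
    have h3 := ih _ h2
    have h4 : x ((y ^ (k + 1)) w) = ((k : ℝ) + 1) • (y ^ k) ((h - (k : ℝ) • 1) w) := by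
      have h5 : (y ^ (k + 1)) (x w) = 0 := by rw [pow_succ]; simp [hw]
      simp only [Module.End.mul_apply, LinearMap.sub_apply, h5, LinearMap.smul_apply] at h1
      rw [h1, zero_sub, ← smul_neg, ← map_neg]
      congr 2
      simp only [LinearMap.sub_apply, LinearMap.add_apply, LinearMap.neg_apply,
        LinearMap.smul_apply, Module.End.one_apply]
      abel
    rw [pow_succ x, Module.End.mul_apply, h4, map_smul, h3, falling, falling,
      Finset.prod_range_succ, map_mul, Module.End.mul_apply, smul_smul, Nat.factorial_succ]
    push_cast
    congr 2
    simp [Nat.cast_smul_eq_nsmul]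

theorem aeval_falling_eq_zero (r : Sl2Rel x h y) {N : ℕ} (hN : y ^ N = 0) {w : V}
    (hw : y (x w) = 0) : aeval h (falling N) w = 0 := by
  have := r.x_pow_y_pow N w hw
  rw [hN, LinearMap.zero_apply, map_zero] at this
  exact (smul_eq_zero.1 this.symm).resolve_left (by positivity)

/-- `rising k = t (t + 1) ⋯ (t + k - 1)`. -/
def rising (k : ℕ) : ℝ[X] := ∏ i ∈ Finset.range k, (X - C (-i : ℝ))

theorem aeval_neg_falling (h : End ℝ V) (k : ℕ) :
    aeval (-h) (falling k) = (-1 : ℝ) ^ k • aeval h (rising k) := by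
  induction k with
  | zero => simp [falling, rising]
  | succ k ih =>
    rw [falling, Finset.prod_range_succ, map_mul, ← falling, ih, rising, rising,
      Finset.prod_range_succ, map_mul, pow_succ, smul_mul_assoc, mul_smul, neg_one_smul,
      ← mul_neg]
    congr 2
    simp
    abel

theorem aeval_rising_eq_zero (r : Sl2Rel x h y) {N : ℕ} (hN : x ^ N = 0) {w : V}
    (hw : y w = 0) : aeval h (rising N) w = 0 := by
  have h1 := r.swap.aeval_falling_eq_zero hN (w := w) (by rw [hw, map_zero])
  rw [aeval_neg_falling] at h1
  exact (smul_eq_zero.1 h1).resolve_left (by simp)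

/-- Since h x = x (h + 2), the operator x raises every root by 2. -/
theorem aeval_shift (r : Sl2Rel x h y) (k : ℕ) (w : V) :
    aeval h (∏ i ∈ Finset.range k, (X - C ((i : ℝ) + 2))) (x w) = x (aeval h (falling k) w) := by
  induction k generalizing w with
  | zero => simp [falling]
  | succ k ih =>
    have h1 : aeval h (X - C ((k : ℝ) + 2)) (x w) = x (aeval h (X - C (k : ℝ)) w) := by
      have := congr($r.hx w)
      simp only [Module.End.mul_apply, LinearMap.add_apply] at this
      simp [this, Algebra.algebraMap_eq_smul_one]
      module
    rw [Finset.prod_range_succ, map_mul, Module.End.mul_apply, h1, ih, falling, falling,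
      Finset.prod_range_succ, map_mul, Module.End.mul_apply]

/-- As a vector of ker y, x w is killed by a polynomial in h with roots ≤ 0; as the image under x of
a vector of ker (y x), by one with roots ≥ 2. The two polynomials are coprime. -/
theorem eq_zero_of_mem_range [FiniteDimensional ℝ V] (r : Sl2Rel x h y) {w : V}
    (hw : y (x w) = 0) : x w = 0 := by
  obtain ⟨N, hN⟩ := r.x_nilpotent
  obtain ⟨M, hM⟩ := r.swap.x_nilpotent
  have h1 := r.aeval_rising_eq_zero hN hw
  have h2 : aeval h (∏ i ∈ Finset.range M, (X - C ((i : ℝ) + 2))) (x w) = 0 := by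
    rw [r.aeval_shift, r.aeval_falling_eq_zero hM hw, map_zero]
  refine (Submodule.disjoint_def.1 (disjoint_ker_aeval_of_isCoprime h ?_)) _ h1 h2
  refine IsCoprime.prod_left fun i _ => IsCoprime.prod_right fun j _ => ?_
  refine isCoprime_X_sub_C_of_isUnit_sub (Ne.isUnit ?_)
  have hi : (0 : ℝ) ≤ i := by positivity
  have hj : (0 : ℝ) ≤ j := by positivity
  linarith

theorem disjoint_ker_range [FiniteDimensional ℝ V] (r : Sl2Rel x h y) :
    Disjoint (LinearMap.ker y) (LinearMap.range x) := by
  rw [Submodule.disjoint_def]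
  rintro _ hv ⟨w, rfl⟩
  exact r.eq_zero_of_mem_range hv

/-- By disjointness ker y embeds in V / range x, whose dimension is that of ker x. Applied also to
the swapped triple, this gives equality and hence V = ker y ⊕ range x. -/
theorem finrank_ker_le [FiniteDimensional ℝ V] (r : Sl2Rel x h y) :
    finrank ℝ (LinearMap.ker y) ≤ finrank ℝ (LinearMap.ker x) := by
  have h1 := Submodule.finrank_add_finrank_le_of_disjoint r.disjoint_ker_range
  have h2 := LinearMap.finrank_range_add_finrank_ker x
  omega

theorem ker_sup_range [FiniteDimensional ℝ V] (r : Sl2Rel x h y) :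
    LinearMap.ker y ⊔ LinearMap.range x = ⊤ := by
  apply Submodule.eq_top_of_finrank_eq
  have h1 := Submodule.finrank_sup_add_finrank_inf_eq (LinearMap.ker y) (LinearMap.range x)
  rw [r.disjoint_ker_range.eq_bot, finrank_bot] at h1
  have h2 := LinearMap.finrank_range_add_finrank_ker x
  have h3 := r.finrank_ker_le
  have h4 := r.swap.finrank_ker_le
  omega

theorem exists_ker_add_range [FiniteDimensional ℝ V] (r : Sl2Rel x h y) (v : V) :
    ∃ a b, y a = 0 ∧ v = a + x b := by
  have : v ∈ LinearMap.ker y ⊔ LinearMap.range x := by rw [r.ker_sup_range]; trivial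
  obtain ⟨a, ha, _, ⟨b, rfl⟩, rfl⟩ := Submodule.mem_sup.1 this
  exact ⟨a, b, ha, rfl⟩

/-- The vectors killed by `y` of weight `-j`. -/
def lowest (h y : End ℝ V) (j : ℕ) : Submodule ℝ V :=
  LinearMap.ker y ⊓ Module.End.eigenspace h (-j : ℝ)

theorem mem_lowest {j : ℕ} {v : V} : v ∈ lowest h y j ↔ y v = 0 ∧ h v = (-j : ℝ) • v := by
  simp [lowest]

/-- The roots 0, -1, …, -(k-1) are simple, so h is diagonalizable on such vectors. In the induction,
h + k removes the root -k; the components of v for the other roots are those of (h + k) v divided by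
k - i, and what is left of v has weight -k. -/
theorem exists_sum_of_aeval_rising (r : Sl2Rel x h y) (k : ℕ) (v : V) (hv : y v = 0)
    (hk : aeval h (rising k) v = 0) :
    ∃ f : ℕ → V, (∀ j, f j ∈ lowest h y j) ∧ v = ∑ j ∈ Finset.range k, f j := by
  induction k generalizing v with
  | zero => exact ⟨0, fun j => zero_mem _, by simpa [rising] using hk⟩
  | succ k ih =>
    have hyh : y (h v) = 0 := by
      have := congr($r.hy v)
      simpa [hv] using this.symm
    obtain ⟨f, hf, hs⟩ := ih (h v + (k : ℝ) • v) (by simp [hv, hyh]) (by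
      rw [rising, Finset.prod_range_succ, map_mul, Module.End.mul_apply] at hk
      simpa [rising, Nat.cast_smul_eq_nsmul] using hk)
    let g : ℕ → V := fun i => ((k : ℝ) - i)⁻¹ • f i
    have hg : ∀ i, g i ∈ lowest h y i := fun i => Submodule.smul_mem _ _ (hf i)
    refine ⟨fun j => if j = k then v - ∑ i ∈ Finset.range k, g i else g j, fun j => ?_, ?_⟩
    · dsimp only
      split_ifs with hj
      · subst hj
        rw [mem_lowest]
        have h1 : ∑ i ∈ Finset.range j, (h (g i) + (j : ℝ) • g i) = h v + (j : ℝ) • v := by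
          rw [hs]
          refine Finset.sum_congr rfl fun i hi => ?_
          have hne : (j : ℝ) - i ≠ 0 := by
            have : (i : ℝ) < j := by exact_mod_cast Finset.mem_range.1 hi
            linarith
          rw [(mem_lowest.1 (hg i)).2, ← add_smul, smul_smul, neg_add_eq_sub,
            mul_inv_cancel₀ hne, one_smul]
        rw [Finset.sum_add_distrib, ← Finset.smul_sum, ← map_sum] at h1
        refine ⟨?_, ?_⟩
        · rw [map_sub, hv, map_sum, Finset.sum_eq_zero fun i _ => (mem_lowest.1 (hg i)).1, sub_zero]
        · rw [map_sub, neg_smul, smul_sub, neg_sub, sub_eq_sub_iff_add_eq_add, ← h1]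
          abel
      · exact hg j
    · rw [Finset.sum_range_succ, if_pos rfl, Finset.sum_congr rfl fun i hi =>
        if_neg (Finset.mem_range.1 hi).ne]
      abel

theorem exists_sum_lowest [FiniteDimensional ℝ V] (r : Sl2Rel x h y) :
    ∃ N : ℕ, ∀ v : V, y v = 0 →
      ∃ f : ℕ → V, (∀ j, f j ∈ lowest h y j) ∧ v = ∑ j ∈ Finset.range N, f j := by
  obtain ⟨N, hN⟩ := r.x_nilpotent
  exact ⟨N, fun v hv => r.exists_sum_of_aeval_rising N v hv (r.aeval_rising_eq_zero hN hv)⟩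

theorem lowest_independent {s : Finset ℕ} {f : ℕ → V} (hf : ∀ j ∈ s, f j ∈ lowest h y j)
    (hs : ∑ j ∈ s, f j = 0) : ∀ j ∈ s, f j = 0 := by
  have hi := (Module.End.eigenspaces_iSupIndep h).comp
    (f := fun j : ℕ => (-j : ℝ)) (fun a b hab => by simpa using hab)
  exact (iSupIndep_iff_finsetSum_eq_zero_imp_eq_zero _).1 hi s f
    (fun j hj => (hf j hj).2) hs

/-- Every submodule containing the strings of lowest weight vectors is everything. -/
theorem eq_top_of_strings [FiniteDimensional ℝ V] (r : Sl2Rel x h y) (S : Submodule ℝ V)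
    (hS : ∀ j k, ∀ v ∈ lowest h y j, (x ^ k) v ∈ S) : S = ⊤ := by
  obtain ⟨N, hN⟩ := r.x_nilpotent
  obtain ⟨M, hM⟩ := r.exists_sum_lowest
  -- Modulo S every vector lies in range (x^m) for all m, by repeated use of V = ker y + range x;
  -- nilpotency of x then finishes.
  have key : ∀ m v, ∃ s ∈ S, ∃ c, v = s + (x ^ m) c := by
    intro m
    induction m with
    | zero => exact fun v => ⟨0, zero_mem _, v, by simp⟩
    | succ m ih =>
      intro v
      obtain ⟨s, hs, c, rfl⟩ := ih v
      obtain ⟨a, b, ha, rfl⟩ := r.exists_ker_add_range c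
      obtain ⟨f, hf, rfl⟩ := hM a ha
      refine ⟨s + (x ^ m) (∑ j ∈ Finset.range M, f j), add_mem hs ?_, b, ?_⟩
      · rw [map_sum]
        exact sum_mem fun j _ => hS j m _ (hf j)
      · rw [map_add, pow_succ, Module.End.mul_apply, add_assoc]
  rw [eq_top_iff]
  intro v _
  obtain ⟨s, hs, c, rfl⟩ := key N v
  simpa [hN] using hs

/-! ### Strings x^k u of lowest weight vectors, and the filtration by kernels of powers of x -/

section Strings

variable {j : ℕ} {u : V}

theorem h_x_pow (r : Sl2Rel x h y) (hu : u ∈ lowest h y j) (k : ℕ) :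
    h ((x ^ k) u) = (2 * k - j : ℝ) • (x ^ k) u := by
  have := congr($(r.h_mul_x_pow k) u)
  simp only [Module.End.mul_apply, LinearMap.add_apply, LinearMap.smul_apply,
    (mem_lowest.1 hu).2, map_smul] at this
  rw [this, ← add_smul]
  congr 1
  ring

theorem y_x_pow (r : Sl2Rel x h y) (hu : u ∈ lowest h y j) (k : ℕ) :
    y ((x ^ (k + 1)) u) = ((k + 1) * (j - k) : ℝ) • (x ^ k) u := by
  have := congr($(r.y_mul_x_pow k) u)
  simp only [Module.End.mul_apply, LinearMap.add_apply, LinearMap.sub_apply,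
    LinearMap.smul_apply, (mem_lowest.1 hu).2, (mem_lowest.1 hu).1, map_smul, map_add, map_zero,
    Module.End.one_apply] at this
  rw [this]
  module

/-- The coefficient (k+1)(j-k) vanishes at k = j, so x^(j+1) u lies in ker y ∩ range x = 0. -/
theorem x_pow_eq_zero [FiniteDimensional ℝ V] (r : Sl2Rel x h y) (hu : u ∈ lowest h y j) {k : ℕ}
    (hk : j < k) : (x ^ k) u = 0 := by
  have h1 : (x ^ (j + 1)) u = 0 := by
    have h2 := r.y_x_pow hu j
    rw [sub_self, mul_zero, zero_smul, pow_succ', Module.End.mul_apply] at h2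
    rw [pow_succ', Module.End.mul_apply, r.eq_zero_of_mem_range h2]
  obtain ⟨m, rfl⟩ := Nat.exists_eq_add_of_le' hk
  rw [pow_add, Module.End.mul_apply, h1, map_zero]

/-- `y ^ k x ^ k` acts on the lowest weight vectors of weight `-j`, `j ≥ k`, by a nonzero scalar. -/
theorem exists_y_pow_x_pow (r : Sl2Rel x h y) {k : ℕ} (hk : k ≤ j) :
    ∃ c : ℝ, c ≠ 0 ∧ ∀ u ∈ lowest h y j, (y ^ k) ((x ^ k) u) = c • u := by
  induction k with
  | zero => exact ⟨1, one_ne_zero, by simp⟩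
  | succ k ih =>
    obtain ⟨c, hc, h1⟩ := ih (by omega)
    refine ⟨((k + 1) * (j - k)) * c, ?_, fun u hu => ?_⟩
    · have : (k : ℝ) < j := by exact_mod_cast hk
      have : (j : ℝ) - k ≠ 0 := by linarith
      positivity
    · rw [pow_succ y, Module.End.mul_apply, r.y_x_pow hu, map_smul, h1 u hu, smul_smul]

theorem y_x_pow_mem (r : Sl2Rel x h y) (k : ℕ) (c : V) : ∃ b, y ((x ^ (k + 1)) c) = (x ^ k) b :=
  ⟨x (y c) - ((k : ℝ) + 1) • (h c + (k : ℝ) • c), by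
    have := congr($(r.y_mul_x_pow k) c)
    simp only [Module.End.mul_apply] at this
    rw [this, pow_succ]
    simp⟩

theorem y_pow_x_pow_mem (r : Sl2Rel x h y) (k m : ℕ) (c : V) :
    ∃ b, (y ^ k) ((x ^ (m + k)) c) = (x ^ m) b := by
  induction k generalizing c with
  | zero => exact ⟨c, rfl⟩
  | succ k ih =>
    obtain ⟨b, hb⟩ := r.y_x_pow_mem (m + k) c
    obtain ⟨d, hd⟩ := ih b
    exact ⟨d, by rw [pow_succ, Module.End.mul_apply, ← add_assoc, hb, hd]⟩

/-- If a sum of `x ^ k u_j`, `j ≥ k`, lies in the range of `x ^ (k + 1)`, all `u_j` vanish. -/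
theorem eq_zero_of_sum_x_pow [FiniteDimensional ℝ V] (r : Sl2Rel x h y) {s : Finset ℕ} {k : ℕ}
    (hk : ∀ j ∈ s, k ≤ j) {f : ℕ → V} (hf : ∀ j ∈ s, f j ∈ lowest h y j) {c : V}
    (hc : (x ^ k) (∑ j ∈ s, f j) = (x ^ (k + 1)) c) : ∀ j ∈ s, f j = 0 := by
  have h1 : ∀ j, ∃ a : ℝ, k ≤ j → a ≠ 0 ∧ ∀ u ∈ lowest h y j, (y ^ k) ((x ^ k) u) = a • u := by
    intro j
    by_cases hj : k ≤ j
    · obtain ⟨a, ha⟩ := r.exists_y_pow_x_pow hj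
      exact ⟨a, fun _ => ha⟩
    · exact ⟨0, fun h => absurd h hj⟩
  choose a ha using h1
  -- Applying y^k to the equation turns the left side into a combination of the u_j with nonzero
  -- coefficients, which lies in ker y, and the right side into an element of range x.
  obtain ⟨b, hb⟩ := r.y_pow_x_pow_mem k 1 c
  have h2 : ∑ j ∈ s, a j • f j = x b := by
    rw [add_comm 1 k, ← hc, map_sum, map_sum, pow_one] at hb
    rw [← hb]
    exact Finset.sum_congr rfl fun j hj => ((ha j (hk j hj)).2 _ (hf j hj)).symm
  have h3 : ∑ j ∈ s, a j • f j = 0 := by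
    rw [h2]
    refine r.eq_zero_of_mem_range ?_
    rw [← h2, map_sum]
    exact Finset.sum_eq_zero fun j hj => by rw [map_smul, (mem_lowest.1 (hf j hj)).1, smul_zero]
  intro j hj
  have h4 := lowest_independent (s := s) (f := fun j => a j • f j)
    (fun j hj => Submodule.smul_mem _ _ (hf j hj)) h3 j hj
  exact (smul_eq_zero.1 h4).resolve_left (ha j (hk j hj)).1

/-- Together with `exists_lowest_add` this identifies the lowest weight space of weight -j with ker
x^(j+1) / (ker x^j + x ker x^(j+2)), in which h and y no longer occur. -/
theorem lowest_disjoint [FiniteDimensional ℝ V] (r : Sl2Rel x h y) (hu : u ∈ lowest h y j)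
    {a c : V} (ha : (x ^ j) a = 0) (huac : u = a + x c) : u = 0 := by
  refine r.eq_zero_of_sum_x_pow (s := {j}) (k := j) (f := fun _ => u) (c := c) (by simp)
    (by simpa using hu) ?_ j (by simp)
  rw [Finset.sum_singleton, huac, map_add, ha, zero_add, pow_succ, Module.End.mul_apply]

theorem exists_lowest_add [FiniteDimensional ℝ V] (r : Sl2Rel x h y) {v : V}
    (hv : (x ^ (j + 1)) v = 0) :
    ∃ u ∈ lowest h y j, ∃ a c, (x ^ j) a = 0 ∧ (x ^ (j + 2)) c = 0 ∧ v = u + (a + x c) := by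
  obtain ⟨b, c, hb, rfl⟩ := r.exists_ker_add_range v
  obtain ⟨M, hM⟩ := r.exists_sum_lowest
  obtain ⟨f, hf, rfl⟩ := hM b hb
  have hlow : ∀ s : Finset ℕ, ∀ k, (∀ i ∈ s, i < k) → (x ^ k) (∑ i ∈ s, f i) = 0 := by
    intro s k hs
    rw [map_sum]
    exact Finset.sum_eq_zero fun i hi => r.x_pow_eq_zero (hf i) (hs i hi)
  have hsplit := Finset.sum_filter_add_sum_filter_not (Finset.range M) (fun i => i < j + 1) f
  -- As x^(j+1) kills v and the components with i ≤ j, it sends the remaining ones into range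
  -- (x^(j+2)), so they vanish. Then i = j supplies u and i < j supplies a.
  have hhigh : ∑ i ∈ Finset.range M with ¬ i < j + 1, f i = 0 := by
    refine Finset.sum_eq_zero (r.eq_zero_of_sum_x_pow (k := j + 1) (c := -c) ?_
      (fun i _ => hf i) ?_)
    · intro i hi
      exact not_lt.1 (Finset.mem_filter.1 hi).2
    · rw [← hsplit, add_assoc, map_add, hlow _ (j + 1) (by simp), zero_add, map_add] at hv
      rw [eq_neg_of_add_eq_zero_left hv, map_neg, pow_succ x (j + 1), Module.End.mul_apply]
  rw [hhigh, add_zero] at hsplit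
  have hsplit2 := Finset.sum_filter_add_sum_filter_not
    ((Finset.range M).filter fun i => i < j + 1) (fun i => i < j) f
  refine ⟨∑ i ∈ (Finset.range M).filter (fun i => i < j + 1) with ¬ i < j, f i, ?_,
    ∑ i ∈ (Finset.range M).filter (fun i => i < j + 1) with i < j, f i, c,
    hlow _ j (by simp), ?_, ?_⟩
  · refine sum_mem fun i hi => ?_
    have : i = j := by
      simp at hi
      omega
    exact this ▸ hf i
  · rw [map_add, ← hsplit, hlow _ (j + 1) (by simp), zero_add] at hv
    rw [pow_succ, Module.End.mul_apply, hv]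
  · rw [← hsplit, ← hsplit2]
    abel

end Strings

end Sl2Rel

end Sl2

/-! ### Positivity of the reduced norm -/

section ReducedNorm

open scoped ComplexOrder

theorem complexify_smul {ι : Type} (c : ℝ) (M : HMat ι) :
    complexify (c • M) = (c : ℂ) • complexify M := by
  ext i k
  rcases i with i | i <;> rcases k with k | k <;>
    apply Complex.ext <;> simp [complexify, quatFst, quatSnd]

theorem complexify_conjTranspose {ι : Type} (M : HMat ι) : complexify Mᴴ = (complexify M)ᴴ := by
  ext i k
  rcases i with i | i <;> rcases k with k | k <;>
    apply Complex.ext <;> simp [complexify, quatFst, quatSnd]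

variable {α β : Type} [Fintype α] [DecidableEq α] [Fintype β] [DecidableEq β]

theorem reducedNorm_apply (M : HMat α) : reducedNorm M = (complexify M).det := rfl

theorem reducedNorm_submatrix (e : α ≃ β) (M : HMat β) :
    reducedNorm (M.submatrix e e) = reducedNorm M := by
  rw [reducedNorm_apply, reducedNorm_apply,
    ← Matrix.det_submatrix_equiv_self (Equiv.sumCongr e e) (complexify M)]
  congr 1
  ext i k
  rcases i with i | i <;> rcases k with k | k <;> rfl

theorem reducedNorm_fromBlocks_zero₂₁ (A : HMat α) (B : Matrix α β ℍ[ℝ]) (D : HMat β) :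
    reducedNorm (Matrix.fromBlocks A B 0 D) = reducedNorm A * reducedNorm D := by
  rw [reducedNorm_apply, reducedNorm_apply, reducedNorm_apply,
    ← Matrix.det_submatrix_equiv_self (Equiv.sumSumSumComm α α β β), ← Matrix.det_fromBlocks_zero₂₁ _
      ((complexify (Matrix.fromBlocks A B 0 D)).submatrix (Equiv.sumSumSumComm α α β β)
        (Equiv.sumSumSumComm α α β β)).toBlocks₁₂]
  congr 1
  ext i k
  rcases i with (i | i) | (i | i) <;> rcases k with (k | k) | (k | k) <;>
    simp [complexify, Matrix.toBlocks₁₂, quatFst_zero, quatSnd_zero]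

theorem reducedNorm_fromBlocks_zero₁₂ (A : HMat α) (C : Matrix β α ℍ[ℝ]) (D : HMat β) :
    reducedNorm (Matrix.fromBlocks A 0 C D) = reducedNorm A * reducedNorm D := by
  rw [mul_comm, ← reducedNorm_fromBlocks_zero₂₁ D C A,
    ← reducedNorm_submatrix (Equiv.sumComm α β)]
  congr 1
  ext1 i k
  rcases i with i | i <;> rcases k with k | k <;> rfl

theorem reducedNorm_fin_one_nonneg (A : HMat (Fin 1)) : 0 ≤ reducedNorm A := by
  have h : reducedNorm A =
      ((Complex.normSq (quatFst (A 0 0)) + Complex.normSq (quatSnd (A 0 0)) : ℝ) : ℂ) := by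
    rw [reducedNorm_apply, ← Matrix.det_submatrix_equiv_self finSumFinEquiv.symm]
    have h0 : (finSumFinEquiv.symm : Fin (1 + 1) ≃ Fin 1 ⊕ Fin 1) 0 = Sum.inl 0 := rfl
    have h1 : (finSumFinEquiv.symm : Fin (1 + 1) ≃ Fin 1 ⊕ Fin 1) 1 = Sum.inr 0 := rfl
    rw [Matrix.det_fin_two]
    simp only [Matrix.submatrix_apply, h0, h1]
    simp [complexify, Complex.mul_conj]
  rw [h, Complex.zero_le_real]
  exact add_nonneg (Complex.normSq_nonneg _) (Complex.normSq_nonneg _)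

/-- A nonzero corner entry q can be eliminated: the reduced norm is then |q|² times that of the
Schur complement. A zero corner is reached as a limit of M + t with t → 0+. -/
theorem reducedNorm_fin_nonneg (n : ℕ) (M : HMat (Fin n)) : 0 ≤ reducedNorm M := by
  induction n with
  | zero => simp [reducedNorm_apply]
  | succ n ih =>
    let e : Fin 1 ⊕ Fin n ≃ Fin (n + 1) := finSumFinEquiv.trans (finCongr (add_comm 1 n))
    rw [← reducedNorm_submatrix e M]
    generalize M.submatrix e e = M'
    have hpivot : ∀ N : HMat (Fin 1 ⊕ Fin n), N (Sum.inl 0) (Sum.inl 0) ≠ 0 →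
        0 ≤ reducedNorm N := by
      intro N hN
      rw [← Matrix.fromBlocks_toBlocks N]
      set A := N.toBlocks₁₁
      let A' : HMat (Fin 1) := Matrix.of fun _ _ => (A 0 0)⁻¹
      have hA : A' * A = 1 := by
        ext1 i k
        fin_cases i
        fin_cases k
        simpa [A', Matrix.mul_apply] using (inv_mul_cancel₀ hN : (A 0 0)⁻¹ * A 0 0 = 1)
      have : Matrix.fromBlocks A N.toBlocks₁₂ N.toBlocks₂₁ N.toBlocks₂₂ =
          Matrix.fromBlocks 1 0 (N.toBlocks₂₁ * A') 1 * Matrix.fromBlocks A N.toBlocks₁₂ 0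
            (N.toBlocks₂₂ - N.toBlocks₂₁ * A' * N.toBlocks₁₂) := by
        rw [Matrix.fromBlocks_multiply]
        simp [Matrix.mul_assoc, hA]
      rw [this, map_mul, reducedNorm_fromBlocks_zero₁₂, reducedNorm_fromBlocks_zero₂₁, map_one,
        map_one, one_mul, one_mul]
      exact mul_nonneg (reducedNorm_fin_one_nonneg _) (ih _)
    by_cases h0 : M' (Sum.inl 0) (Sum.inl 0) = 0
    · let f : ℝ → ℂ := fun t => reducedNorm (M' + t • (1 : HMat (Fin 1 ⊕ Fin n)))
      have hf : Continuous f := by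
        have : f = fun t : ℝ => (complexify M' + (t : ℂ) • complexify 1).det := by
          funext t
          simp only [f]
          rw [reducedNorm_apply, complexify_add, complexify_smul]
        rw [this]
        fun_prop
      have hpos : ∀ t ∈ Set.Ioi (0 : ℝ), f t ∈ Set.Ici (0 : ℂ) := fun t ht =>
        hpivot _ (by simpa [h0] using (Set.mem_Ioi.1 ht).ne')
      have h2 : f 0 ∈ closure (Set.Ici (0 : ℂ)) :=
        map_mem_closure hf (by rw [closure_Ioi]; exact Set.self_mem_Ici) hpos
      rw [isClosed_Ici.closure_eq] at h2
      simpa [f] using h2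
    · exact hpivot M' h0

theorem reducedNorm_nonneg (M : HMat α) : 0 ≤ reducedNorm M := by
  rw [← reducedNorm_submatrix (Fintype.equivFin α).symm M]
  exact reducedNorm_fin_nonneg _ _

/-- Reduced norms of gᴴ J g = J give Nrd(g)² = 1, since Nrd(g) is real; nonnegativity excludes -1.
-/
theorem mem_quatSL_of_isometry {J : HMat α} (hJ : IsUnit J) {g : (HMat α)ˣ}
    (hg : g ∈ quatIsometry J) : g ∈ quatSL α := by
  have h1 : (g : HMat α)ᴴ * J * (g : HMat α) = J := hg
  have h2 := congrArg reducedNorm h1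
  have h3 : reducedNorm (g : HMat α)ᴴ = star (reducedNorm (g : HMat α)) := by
    rw [reducedNorm_apply, complexify_conjTranspose, Matrix.det_conjTranspose, ← reducedNorm_apply]
  have h4 : reducedNorm J ≠ 0 := (hJ.map reducedNorm).ne_zero
  obtain ⟨r, hr⟩ : ∃ r : ℝ, (r : ℂ) = reducedNorm (g : HMat α) :=
    ⟨_, (Complex.eq_re_of_ofReal_le (r := 0) (by simpa using reducedNorm_nonneg _)).symm⟩
  have h5 : 0 ≤ r := by
    have := reducedNorm_nonneg (g : HMat α)
    rwa [← hr, Complex.zero_le_real] at this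
  rw [map_mul, map_mul, h3, mul_right_comm, mul_eq_right₀ h4, ← hr] at h2
  have h6 : r * r = 1 := by
    rw [Complex.star_def, Complex.conj_ofReal] at h2
    exact_mod_cast h2
  have h7 : r = 1 := by nlinarith
  rw [quatSL, MonoidHom.mem_ker]
  ext
  simp [← hr, h7]

end ReducedNorm

/-! ### SO*(2n) and Sp(p,q) as full isometry groups -/

theorem quatJ_mul_self : quatJ * quatJ = -1 := by
  have h : quatJ.re = 0 ∧ quatJ.imI = 0 ∧ quatJ.imJ = 1 ∧ quatJ.imK = 0 := ⟨rfl, rfl, rfl, rfl⟩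
  ext <;> simp [h]

theorem isUnit_skewMatrix (n : ℕ) : IsUnit (skewMatrix n) := by
  have h : skewMatrix n * -skewMatrix n = 1 := by
    simp [skewMatrix, Matrix.diagonal_mul_diagonal, quatJ_mul_self, ← Matrix.diagonal_neg]
  have h' : -skewMatrix n * skewMatrix n = 1 := by rw [← h, neg_mul, mul_neg]
  exact ⟨⟨_, _, h, h'⟩, rfl⟩

theorem isUnit_signatureMatrix (p q : ℕ) : IsUnit (signatureMatrix p q) := by
  have h : signatureMatrix p q * signatureMatrix p q = 1 := by
    rw [signatureMatrix, Matrix.diagonal_mul_diagonal, ← Matrix.diagonal_one]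
    congr 1
    funext i
    rcases i with i | i <;> simp
  exact ⟨⟨_, _, h, h⟩, rfl⟩

theorem SOStar_eq (n : ℕ) : SOStar n = quatIsometry (skewMatrix n) :=
  inf_eq_right.2 fun _ => mem_quatSL_of_isometry (isUnit_skewMatrix n)

theorem SpPQ_eq (p q : ℕ) : SpPQ p q = quatIsometry (signatureMatrix p q) :=
  inf_eq_right.2 fun _ => mem_quatSL_of_isometry (isUnit_signatureMatrix p q)

/-! ### The action of quaternionic matrices on columns -/

section Columns

open MulOpposite

variable {n : ℕ}

/-- The action of matrices on columns, by real-linear maps. -/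
def realAction : HMat (Fin n) →+* Module.End ℝ (Fin n → ℍ[ℝ]) where
  toFun M :=
    { toFun := fun v => M *ᵥ v
      map_add' := Matrix.mulVec_add M
      map_smul' := fun c v => Matrix.mulVec_smul M c v }
  map_one' := LinearMap.ext fun v => by simp
  map_mul' M N := LinearMap.ext fun v => by simp
  map_zero' := LinearMap.ext fun v => by simp
  map_add' M N := LinearMap.ext fun v => by simp [Matrix.add_mulVec]

@[simp]
theorem realAction_apply (M : HMat (Fin n)) (v : Fin n → ℍ[ℝ]) : realAction M v = M *ᵥ v := rfl

theorem realAction_pow_apply (M : HMat (Fin n)) (k : ℕ) (v : Fin n → ℍ[ℝ]) :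
    (realAction M ^ k) v = (M ^ k) *ᵥ v := by
  rw [← map_pow, realAction_apply]

/-- The action of matrices on columns, by right `ℍ`-linear maps. -/
def columnAction : HMat (Fin n) →+* Module.End ℍ[ℝ]ᵐᵒᵖ (Fin n → ℍ[ℝ]) where
  toFun M :=
    { toFun := fun v => M *ᵥ v
      map_add' := Matrix.mulVec_add M
      map_smul' := fun c v => Matrix.mulVec_smul M c v }
  map_one' := LinearMap.ext fun v => by simp
  map_mul' M N := LinearMap.ext fun v => by simp
  map_zero' := LinearMap.ext fun v => by simp
  map_add' M N := LinearMap.ext fun v => by simp [Matrix.add_mulVec]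

instance finite_columns : Module.Finite ℍ[ℝ]ᵐᵒᵖ (Fin n → ℍ[ℝ]) :=
  Module.Finite.of_restrictScalars_finite ℝ _ _

theorem finrank_columns : Module.finrank ℍ[ℝ]ᵐᵒᵖ (Fin n → ℍ[ℝ]) = n := by
  have : Module.finrank ℍ[ℝ]ᵐᵒᵖ ℍ[ℝ] = 1 := by
    refine finrank_eq_one (v := (1 : ℍ[ℝ])) one_ne_zero fun w => ⟨op w, by simp⟩
  let e : (Fin n → ℍ[ℝ]) ≃ₗ[ℍ[ℝ]ᵐᵒᵖ] (Fin n → ℍ[ℝ]ᵐᵒᵖ) :=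
    { toFun := fun v i => op (v i)
      invFun := fun v i => unop (v i)
      left_inv := fun v => rfl
      right_inv := fun v => rfl
      map_add' := fun v u => rfl
      map_smul' := fun c v => by
        funext i
        apply unop_injective
        simp }
  rw [e.finrank_eq, Module.finrank_fin_fun]

theorem skewForm_add_right (v u w : Fin n → ℍ[ℝ]) :
    skewForm v (u + w) = skewForm v u + skewForm v w := by
  simp [skewForm, Matrix.mulVec_add]

theorem skewForm_add_left (v u w : Fin n → ℍ[ℝ]) :
    skewForm (v + u) w = skewForm v w + skewForm u w := by
  simp [skewForm]

theorem skewForm_smul_right (v u : Fin n → ℍ[ℝ]) (a : ℍ[ℝ]) :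
    skewForm v (op a • u) = skewForm v u * a := by
  simp [skewForm, Matrix.mulVec_smul, dotProduct, Finset.sum_mul, mul_assoc]

theorem skewForm_smul_left (v u : Fin n → ℍ[ℝ]) (a : ℍ[ℝ]) :
    skewForm (op a • v) u = star a * skewForm v u := by
  simp [skewForm, dotProduct, Finset.mul_sum, mul_assoc]

theorem skewForm_real_smul_right (v u : Fin n → ℍ[ℝ]) (c : ℝ) :
    skewForm v (c • u) = c • skewForm v u := by
  simp [skewForm, Matrix.mulVec_smul]

theorem skewForm_real_smul_left (v u : Fin n → ℍ[ℝ]) (c : ℝ) :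
    skewForm (c • v) u = c • skewForm v u := by
  simp [skewForm, dotProduct, Finset.smul_sum, Quaternion.star_smul]

theorem skewForm_zero_right (v : Fin n → ℍ[ℝ]) : skewForm v 0 = 0 := by simp [skewForm]

theorem skewForm_zero_left (v : Fin n → ℍ[ℝ]) : skewForm 0 v = 0 := by simp [skewForm]

theorem skewForm_sum_right {κ : Type} (s : Finset κ) (v : Fin n → ℍ[ℝ]) (f : κ → Fin n → ℍ[ℝ]) :
    skewForm v (∑ k ∈ s, f k) = ∑ k ∈ s, skewForm v (f k) :=
  map_sum (AddMonoidHom.mk' (skewForm v) (skewForm_add_right v)) f s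

theorem skewForm_sum_left {κ : Type} (s : Finset κ) (v : Fin n → ℍ[ℝ]) (f : κ → Fin n → ℍ[ℝ]) :
    skewForm (∑ k ∈ s, f k) v = ∑ k ∈ s, skewForm (f k) v :=
  map_sum (AddMonoidHom.mk' (fun w => skewForm w v) fun u w => skewForm_add_left u w v) f s

theorem star_quatJ : star quatJ = -quatJ := by
  have h : quatJ.re = 0 ∧ quatJ.imI = 0 ∧ quatJ.imJ = 1 ∧ quatJ.imK = 0 := ⟨rfl, rfl, rfl, rfl⟩
  ext <;> simp [h]

theorem star_skewForm (v u : Fin n → ℍ[ℝ]) : star (skewForm v u) = -skewForm u v := by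
  simp [skewForm, skewMatrix, dotProduct, Matrix.mulVec_diagonal, star_quatJ, mul_assoc]

theorem skewForm_mulVec_left (M : HMat (Fin n)) (v u : Fin n → ℍ[ℝ]) :
    skewForm (M *ᵥ v) u = star v ⬝ᵥ ((Mᴴ * skewMatrix n) *ᵥ u) := by
  rw [skewForm, Matrix.star_mulVec, ← Matrix.dotProduct_mulVec, Matrix.mulVec_mulVec]

theorem skewForm_mulVec_right (M : HMat (Fin n)) (v u : Fin n → ℍ[ℝ]) :
    skewForm v (M *ᵥ u) = star v ⬝ᵥ ((skewMatrix n * M) *ᵥ u) := by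
  rw [skewForm, Matrix.mulVec_mulVec]

theorem skewForm_lie {Z : HMat (Fin n)} (hZ : Z ∈ soStar n) (v u : Fin n → ℍ[ℝ]) :
    skewForm (Z *ᵥ v) u = -skewForm v (Z *ᵥ u) := by
  rw [skewForm_mulVec_left, skewForm_mulVec_right, eq_neg_of_add_eq_zero_left hZ.2,
    Matrix.neg_mulVec, dotProduct_neg]

theorem skewForm_lie_pow {Z : HMat (Fin n)} (hZ : Z ∈ soStar n) (k : ℕ) (v u : Fin n → ℍ[ℝ]) :
    skewForm ((Z ^ k) *ᵥ v) u = (-1 : ℝ) ^ k • skewForm v ((Z ^ k) *ᵥ u) := by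
  induction k generalizing u with
  | zero => simp
  | succ k ih =>
    rw [pow_succ' Z, ← Matrix.mulVec_mulVec, skewForm_lie hZ, ih, Matrix.mulVec_mulVec, ← pow_succ,
      ← pow_succ', pow_succ (-1 : ℝ), mul_neg_one, neg_smul]

theorem skewForm_isometry {g : (HMat (Fin n))ˣ} (hg : g ∈ SOStar n) (v u : Fin n → ℍ[ℝ]) :
    skewForm ((g : HMat (Fin n)) *ᵥ v) ((g : HMat (Fin n)) *ᵥ u) = skewForm v u := by
  have h : (g : HMat (Fin n))ᴴ * skewMatrix n * (g : HMat (Fin n)) = skewMatrix n := hg.2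
  rw [skewForm_mulVec_left, Matrix.mulVec_mulVec, h, skewForm]

theorem skewForm_single (v : Fin n → ℍ[ℝ]) (i : Fin n) (a : ℍ[ℝ]) :
    skewForm v (Pi.single i a) = star (v i) * (quatJ * a) := by
  rw [skewForm, skewMatrix, dotProduct, Finset.sum_eq_single i]
  · simp [Matrix.mulVec_diagonal]
  · intro j _ hj
    simp [Matrix.mulVec_diagonal, hj]
  · simp

theorem skewForm_nondegenerate {v : Fin n → ℍ[ℝ]} (hv : ∀ u, skewForm v u = 0) : v = 0 := by
  funext i
  have h := hv (Pi.single i quatJ)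
  rw [skewForm_single, quatJ_mul_self] at h
  simpa using h

end Columns

/-! ### The spaces of lowest weight vectors -/

section LowestWeight

variable {n : ℕ} {X H Y : HMat (Fin n)}

theorem sl2Rel_of_isSl2Triple {X H Y : soStar n} (h : IsSl2Triple H X Y) :
    Sl2Rel (X : HMat (Fin n)) (H : HMat (Fin n)) (Y : HMat (Fin n)) where
  xy := congrArg Subtype.val h.lie_e_f
  hx := by
    have h1 : (H : HMat (Fin n)) * X - X * H = 2 • (X : HMat (Fin n)) :=
      congrArg Subtype.val h.lie_h_e_nsmul
    rw [two_mul, ← two_nsmul, sub_eq_iff_eq_add'.1 h1]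
  hy := by
    have h1 : (H : HMat (Fin n)) * Y - Y * H = -(2 • (Y : HMat (Fin n))) :=
      congrArg Subtype.val h.lie_h_f_nsmul
    rw [two_mul, ← two_nsmul, sub_eq_iff_eq_add'.1 h1, sub_eq_add_neg]

theorem mem_lowestWeightSpace_iff {d : ℕ} {v : Fin n → ℍ[ℝ]} :
    v ∈ lowestWeightSpace H Y d ↔ Y *ᵥ v = 0 ∧ H *ᵥ v = (1 - (d : ℝ)) • v := Iff.rfl

theorem mem_lowestWeightSpace_succ {j : ℕ} {v : Fin n → ℍ[ℝ]} :
    v ∈ lowestWeightSpace H Y (j + 1) ↔ v ∈ Sl2Rel.lowest (realAction H) (realAction Y) j := by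
  rw [Sl2Rel.mem_lowest, mem_lowestWeightSpace_iff]
  simp

/-- `ker X ^ j + X (ker X ^ (j + 2))`. -/
def jordanRest (X : HMat (Fin n)) (j : ℕ) : Submodule ℍ[ℝ]ᵐᵒᵖ (Fin n → ℍ[ℝ]) :=
  LinearMap.ker (columnAction (X ^ j)) ⊔
    (LinearMap.ker (columnAction (X ^ (j + 2)))).map (columnAction X)

theorem mem_jordanRest {j : ℕ} {v : Fin n → ℍ[ℝ]} : v ∈ jordanRest X j ↔
    ∃ a c, (X ^ j) *ᵥ a = 0 ∧ (X ^ (j + 2)) *ᵥ c = 0 ∧ v = a + X *ᵥ c := by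
  rw [jordanRest, Submodule.mem_sup]
  constructor
  · rintro ⟨a, ha, _, ⟨c, hc, rfl⟩, rfl⟩
    exact ⟨a, c, ha, hc, rfl⟩
  · rintro ⟨a, c, ha, hc, rfl⟩
    exact ⟨a, ha, _, ⟨c, hc, rfl⟩, rfl⟩

theorem jordanRest_le_ker (j : ℕ) {v : Fin n → ℍ[ℝ]} (hv : v ∈ jordanRest X j) :
    (X ^ (j + 1)) *ᵥ v = 0 := by
  obtain ⟨a, c, ha, hc, rfl⟩ := mem_jordanRest.1 hv
  rw [Matrix.mulVec_add, Matrix.mulVec_mulVec, ← pow_succ, hc, add_zero, pow_succ',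
    ← Matrix.mulVec_mulVec, ha, Matrix.mulVec_zero]

theorem X_pow_mulVec_lowest (r : Sl2Rel (realAction X) (realAction H) (realAction Y)) {j : ℕ}
    {v : Fin n → ℍ[ℝ]} (hv : v ∈ lowestWeightSpace H Y (j + 1)) {k : ℕ} (hk : j < k) :
    (X ^ k) *ᵥ v = 0 := by
  rw [← realAction_pow_apply]
  exact r.x_pow_eq_zero (mem_lowestWeightSpace_succ.1 hv) hk

/-- With `range_map_lowestWeightSpace`: L(j) is isomorphic to ker X^(j+1) / `jordanRest X j`, a
quotient independent of H and Y. -/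
theorem ker_map_lowestWeightSpace (r : Sl2Rel (realAction X) (realAction H) (realAction Y))
    (j : ℕ) : LinearMap.ker ((jordanRest X j).mkQ ∘ₗ (lowestWeightSpace H Y (j + 1)).subtype) =
      ⊥ := by
  rw [LinearMap.ker_eq_bot']
  rintro ⟨v, hv⟩ h
  rw [LinearMap.comp_apply, Submodule.mkQ_apply, Submodule.Quotient.mk_eq_zero,
    Submodule.subtype_apply] at h
  obtain ⟨a, c, ha, -, hac⟩ := mem_jordanRest.1 h
  rw [← realAction_pow_apply] at ha
  exact Subtype.ext (r.lowest_disjoint (mem_lowestWeightSpace_succ.1 hv) ha hac)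

theorem range_map_lowestWeightSpace (r : Sl2Rel (realAction X) (realAction H) (realAction Y))
    (j : ℕ) : LinearMap.range ((jordanRest X j).mkQ ∘ₗ (lowestWeightSpace H Y (j + 1)).subtype) =
      (LinearMap.ker (columnAction (X ^ (j + 1)))).map (jordanRest X j).mkQ := by
  apply le_antisymm
  · rintro _ ⟨⟨v, hv⟩, rfl⟩
    exact ⟨v, X_pow_mulVec_lowest r hv (Nat.lt_succ_self j), rfl⟩
  · rintro _ ⟨v, hv, rfl⟩
    have hv' : (realAction X ^ (j + 1)) v = 0 := by rw [realAction_pow_apply]; exact hv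
    obtain ⟨u, hu, a, c, ha, hc, rfl⟩ := r.exists_lowest_add hv'
    refine ⟨⟨u, mem_lowestWeightSpace_succ.2 hu⟩, ?_⟩
    rw [LinearMap.comp_apply, Submodule.mkQ_apply, Submodule.mkQ_apply, eq_comm,
      Submodule.Quotient.eq, Submodule.subtype_apply, add_sub_cancel_left]
    rw [realAction_pow_apply] at ha hc
    exact mem_jordanRest.2 ⟨a, c, ha, hc, rfl⟩

/-- For w = a + X c one has X^j w = X^(j+1) c, and X^(j+1) can be moved onto v. So the form v, w ↦
⟨v, X^j w⟩ on ker X^(j+1) descends to the quotient by `jordanRest X j`. -/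
theorem skewForm_jordanRest_right (hX : X ∈ soStar n) {j : ℕ} {v w : Fin n → ℍ[ℝ]}
    (hv : (X ^ (j + 1)) *ᵥ v = 0) (hw : w ∈ jordanRest X j) :
    skewForm v ((X ^ j) *ᵥ w) = 0 := by
  obtain ⟨a, c, ha, -, rfl⟩ := mem_jordanRest.1 hw
  have h := skewForm_lie_pow hX (j + 1) v c
  rw [hv, skewForm_zero_left] at h
  rw [Matrix.mulVec_add, ha, zero_add, Matrix.mulVec_mulVec, ← pow_succ]
  exact (smul_eq_zero.1 h.symm).resolve_left (by simp)

theorem skewForm_jordanRest_left (hX : X ∈ soStar n) {j : ℕ} {v w : Fin n → ℍ[ℝ]}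
    (hv : (X ^ (j + 1)) *ᵥ v = 0) (hw : w ∈ jordanRest X j) :
    skewForm w ((X ^ j) *ᵥ v) = 0 := by
  have h := star_skewForm w ((X ^ j) *ᵥ v)
  rw [skewForm_lie_pow hX, skewForm_jordanRest_right hX hv hw, smul_zero, neg_zero] at h
  exact star_eq_zero.1 h

/-- Both spaces are identified with the same quotient of ker X^(j+1), and the identifications
respect the form induced there. Conjugacy of triples sharing X is not needed. -/
theorem exists_isometry_lowestWeightSpace {H' Y' : HMat (Fin n)} (hX : X ∈ soStar n)
    (r : Sl2Rel (realAction X) (realAction H) (realAction Y))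
    (r' : Sl2Rel (realAction X) (realAction H') (realAction Y')) {d : ℕ} (hd : 1 ≤ d) :
    ∃ e : lowestWeightSpace H' Y' d ≃ₗ[ℍ[ℝ]ᵐᵒᵖ] lowestWeightSpace H Y d,
      ∀ v u, lowestWeightForm X H Y d (e v) (e u) = lowestWeightForm X H' Y' d v u := by
  obtain ⟨j, rfl⟩ := Nat.exists_eq_add_of_le' hd
  have hi := LinearMap.ker_eq_bot.1 (ker_map_lowestWeightSpace r j)
  have hi' := LinearMap.ker_eq_bot.1 (ker_map_lowestWeightSpace r' j)
  let e := (LinearEquiv.ofInjective _ hi').trans ((LinearEquiv.ofEq _ _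
    ((range_map_lowestWeightSpace r' j).trans (range_map_lowestWeightSpace r j).symm)).trans
    (LinearEquiv.ofInjective _ hi).symm)
  have he : ∀ v, ∃ w ∈ jordanRest X j, ((e v : _) : Fin n → ℍ[ℝ]) = v + w := by
    intro v
    have h1 := congrArg Subtype.val ((LinearEquiv.ofInjective _ hi).apply_symm_apply
      (LinearEquiv.ofEq _ _
        ((range_map_lowestWeightSpace r' j).trans (range_map_lowestWeightSpace r j).symm)
        (LinearEquiv.ofInjective _ hi' v)))
    refine ⟨e v - v, ?_, by abel⟩
    rw [← Submodule.Quotient.eq]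
    exact h1
  refine ⟨e, fun v u => ?_⟩
  obtain ⟨w, hw, hv⟩ := he v
  obtain ⟨z, hz, hu⟩ := he u
  have hv' := X_pow_mulVec_lowest r' v.2 (Nat.lt_succ_self j)
  have hu' := X_pow_mulVec_lowest r' u.2 (Nat.lt_succ_self j)
  rw [lowestWeightForm, lowestWeightForm, hv, hu, Nat.add_sub_cancel, Matrix.mulVec_add,
    skewForm_add_right, skewForm_add_left, skewForm_add_left, skewForm_jordanRest_right hX hv' hz,
    skewForm_jordanRest_left hX hu' hw,
    skewForm_jordanRest_right hX (jordanRest_le_ker j hw) hz]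
  simp

/-- Conjugating a triple does not change the forms on the lowest weight spaces. -/
theorem exists_isometry_conj {g : (HMat (Fin n))ˣ} (hg : g ∈ SOStar n) (d : ℕ)
    {X' H' Y' : HMat (Fin n)} (hX : X' * g = g * X) (hH : H' * g = g * H) (hY : Y' * g = g * Y) :
    ∃ e : lowestWeightSpace H' Y' d ≃ₗ[ℍ[ℝ]ᵐᵒᵖ] lowestWeightSpace H Y d,
      ∀ v u, lowestWeightForm X H Y d (e v) (e u) = lowestWeightForm X' H' Y' d v u := by
  have hXk : ∀ k : ℕ, X' ^ k * g = g * X ^ k := fun k =>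
    ((show SemiconjBy (g : HMat (Fin n)) X X' from hX.symm).pow_right k).eq.symm
  have hinv : ∀ {A B : HMat (Fin n)}, A * g = g * B →
      B * ((g⁻¹ : (HMat (Fin n))ˣ) : HMat (Fin n)) = (g⁻¹ : (HMat (Fin n))ˣ) * A := by
    intro A B hAB
    rw [Units.eq_inv_mul_iff_mul_eq, ← mul_assoc, ← hAB, mul_assoc, Units.mul_inv, mul_one]
  have hmem : ∀ {A B C D : HMat (Fin n)} {k : (HMat (Fin n))ˣ}, A * k = k * B → C * k = k * D →
      ∀ v ∈ lowestWeightSpace B D d, (k : HMat (Fin n)) *ᵥ v ∈ lowestWeightSpace A C d := by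
    rintro A B C D k hAB hCD v ⟨h1, h2⟩
    refine ⟨?_, ?_⟩
    · rw [Matrix.mulVec_mulVec, hCD, ← Matrix.mulVec_mulVec, h1, Matrix.mulVec_zero]
    · rw [Matrix.mulVec_mulVec, hAB, ← Matrix.mulVec_mulVec, h2, Matrix.mulVec_smul]
  let e : lowestWeightSpace H' Y' d ≃ₗ[ℍ[ℝ]ᵐᵒᵖ] lowestWeightSpace H Y d :=
    { toFun := fun v => ⟨((g⁻¹ : (HMat (Fin n))ˣ) : HMat (Fin n)) *ᵥ (v : Fin n → ℍ[ℝ]),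
        hmem (hinv hH) (hinv hY) _ v.2⟩
      invFun := fun v => ⟨(g : HMat (Fin n)) *ᵥ (v : Fin n → ℍ[ℝ]), hmem hH hY _ v.2⟩
      left_inv := fun v => Subtype.ext (by simp)
      right_inv := fun v => Subtype.ext (by simp)
      map_add' := fun v u => Subtype.ext (by simp [Matrix.mulVec_add])
      map_smul' := fun c v => Subtype.ext (by simp [Matrix.mulVec_smul]) }
  refine ⟨e, fun v u => ?_⟩
  obtain ⟨w, rfl⟩ := e.symm.surjective v
  obtain ⟨z, rfl⟩ := e.symm.surjective u
  rw [e.apply_symm_apply, e.apply_symm_apply]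
  change _ = skewForm ((g : HMat (Fin n)) *ᵥ (w : Fin n → ℍ[ℝ]))
    ((X' ^ (d - 1)) *ᵥ ((g : HMat (Fin n)) *ᵥ (z : Fin n → ℍ[ℝ])))
  rw [Matrix.mulVec_mulVec, hXk, ← Matrix.mulVec_mulVec, skewForm_isometry hg]
  rfl

end LowestWeight

/-! ### Skew-Hermitian forms over the quaternions -/

section SkewHermitian

open MulOpposite

/-- The quaternion unit `i`. -/
def quatI : ℍ[ℝ] := ⟨0, 1, 0, 0⟩

theorem quatI_ne_zero : quatI ≠ 0 := fun h =>
  one_ne_zero (α := ℝ) (congrArg (fun q : ℍ[ℝ] => q.imI) h)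

theorem star_quatI : star quatI = -quatI := by
  have h : quatI.re = 0 ∧ quatI.imI = 1 ∧ quatI.imJ = 0 ∧ quatI.imK = 0 := ⟨rfl, rfl, rfl, rfl⟩
  ext <;> simp [h]

theorem quatJ_mul_quatI : quatJ * quatI = -(quatI * quatJ) := by
  have h : quatI.re = 0 ∧ quatI.imI = 1 ∧ quatI.imJ = 0 ∧ quatI.imK = 0 := ⟨rfl, rfl, rfl, rfl⟩
  have h' : quatJ.re = 0 ∧ quatJ.imI = 0 ∧ quatJ.imJ = 1 ∧ quatJ.imK = 0 := ⟨rfl, rfl, rfl, rfl⟩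
  ext <;> simp [h, h']

theorem exists_conj_eq_quatJ {q : ℍ[ℝ]} (hq : star q = -q) (h0 : q ≠ 0) :
    ∃ a : ℍ[ℝ], star a * q * a = quatJ := by
  set s : ℝ := ‖q‖
  have hs : 0 < s := norm_pos_iff.2 h0
  have hqq : q * q = -((s * s : ℝ) : ℍ[ℝ]) := by
    have h1 := Quaternion.star_mul_self q
    rw [hq, Quaternion.normSq_eq_norm_mul_self, neg_mul] at h1
    rw [← h1, neg_neg]
  -- From q² = -s², the element a = s - q j satisfies q a = s a j. It vanishes only for q = -s j,
  -- where a = i serves instead.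
  obtain ⟨a, ha, haq⟩ : ∃ a : ℍ[ℝ], a ≠ 0 ∧ q * a = s • (a * quatJ) := by
    by_cases hj : (s : ℍ[ℝ]) - q * quatJ = 0
    · refine ⟨quatI, quatI_ne_zero, ?_⟩
      have h1 : q = -(s : ℍ[ℝ]) * quatJ := by
        have h2 := congrArg (· * quatJ) (sub_eq_zero.1 hj)
        simp only [mul_assoc, quatJ_mul_self, mul_neg_one] at h2
        rw [neg_mul, h2, neg_neg]
      rw [h1, mul_assoc, quatJ_mul_quatI, neg_mul_neg, Quaternion.coe_mul_eq_smul]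
    · refine ⟨_, hj, ?_⟩
      rw [mul_sub, ← mul_assoc, hqq, sub_mul, mul_assoc q, quatJ_mul_self,
        ← Quaternion.coe_mul_eq_smul, mul_sub, ← Quaternion.coe_commutes s q, mul_neg_one]
      push_cast
      noncomm_ring
  have hn : 0 < Quaternion.normSq a := lt_of_le_of_ne (Quaternion.normSq_nonneg)
    (Quaternion.normSq_ne_zero.2 ha).symm
  -- Here star a * q * a = s |a|² j, so this real scaling normalizes the factor to 1.
  set c : ℝ := (√(s * Quaternion.normSq a))⁻¹
  refine ⟨c • a, ?_⟩
  have h2 : star a * q * a = (s * Quaternion.normSq a) • quatJ := by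
    rw [mul_assoc, haq, mul_smul_comm, ← mul_assoc, Quaternion.star_mul_self,
      Quaternion.coe_mul_eq_smul, smul_smul]
  rw [Quaternion.star_smul, smul_mul_assoc, smul_mul_assoc, mul_smul_comm, h2, smul_smul, smul_smul]
  have h3 : c * c * (s * Quaternion.normSq a) = 1 := by
    have h4 : 0 < s * Quaternion.normSq a := mul_pos hs hn
    rw [← mul_inv, Real.mul_self_sqrt h4.le, inv_mul_cancel₀ h4.ne']
  rw [h3, one_smul]

variable {V : Type} [AddCommGroup V] [Module ℍ[ℝ]ᵐᵒᵖ V]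

/-- Skew-Hermitian forms on a right vector space over the quaternions. -/
structure IsSkewHermitian (B : V → V → ℍ[ℝ]) : Prop where
  add_right : ∀ v u w, B v (u + w) = B v u + B v w
  smul_right : ∀ v u a, B v (op a • u) = B v u * a
  star_eq : ∀ v u, star (B v u) = -B u v

namespace IsSkewHermitian

variable {B : V → V → ℍ[ℝ]}

theorem eq_neg_star (hB : IsSkewHermitian B) (v u : V) : B v u = -star (B u v) := by
  rw [hB.star_eq, neg_neg]

theorem add_left (hB : IsSkewHermitian B) (v u w : V) : B (v + u) w = B v w + B u w := by
  rw [hB.eq_neg_star, hB.add_right, star_add, neg_add, ← hB.eq_neg_star, ← hB.eq_neg_star]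

theorem smul_left (hB : IsSkewHermitian B) (v u : V) (a : ℍ[ℝ]) :
    B (op a • v) u = star a * B v u := by
  rw [hB.eq_neg_star, hB.smul_right, star_mul, ← mul_neg, ← hB.eq_neg_star]

theorem sum_right (hB : IsSkewHermitian B) {κ : Type} (s : Finset κ) (v : V) (f : κ → V) :
    B v (∑ k ∈ s, f k) = ∑ k ∈ s, B v (f k) :=
  map_sum (AddMonoidHom.mk' (B v) (hB.add_right v)) f s

/-- If B v v vanished on W, polarizing at x + y a would make B(x,y) a self-conjugate for all a,
hence every quaternion real; a = B(x,y)⁻¹ i contradicts this. -/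
theorem exists_anisotropic (hB : IsSkewHermitian B) (W : Submodule ℍ[ℝ]ᵐᵒᵖ V) {x y : V}
    (hx : x ∈ W) (hy : y ∈ W) (hxy : B x y ≠ 0) : ∃ v ∈ W, B v v ≠ 0 := by
  by_contra! h
  have h1 : ∀ a : ℍ[ℝ], star (B x y * a) = B x y * a := by
    intro a
    have h2 := h (x + op a • y) (add_mem hx (W.smul_mem _ hy))
    rw [hB.add_left, hB.add_right, hB.add_right, h x hx, h _ (W.smul_mem _ hy), zero_add, add_zero,
      hB.eq_neg_star (op a • y) x, add_neg_eq_zero, hB.smul_right] at h2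
    exact h2.symm
  have h3 := h1 ((B x y)⁻¹ * quatI)
  rw [mul_inv_cancel_left₀ hxy, star_quatI] at h3
  have h4 : (-1 : ℝ) = 1 := congrArg (fun q : ℍ[ℝ] => q.imI) h3
  norm_num at h4

theorem linearIndependent (hB : IsSkewHermitian B) {κ : Type} [Fintype κ] [DecidableEq κ]
    {f : κ → V} (hf : ∀ r s, B (f r) (f s) = if r = s then quatJ else 0) :
    LinearIndependent ℍ[ℝ]ᵐᵒᵖ f := by
  rw [Fintype.linearIndependent_iff]
  intro c hc r
  have h1 : B (f r) (∑ s, c s • f s) = quatJ * unop (c r) := by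
    rw [hB.sum_right, Finset.sum_eq_single r]
    · rw [← op_unop (c r), hB.smul_right, hf, if_pos rfl, op_unop]
    · intro s _ hs
      rw [← op_unop (c s), hB.smul_right, hf, if_neg hs.symm, zero_mul]
    · simp
  have h2 : B (f r) 0 = 0 := map_zero (AddMonoidHom.mk' (B (f r)) (hB.add_right (f r)))
  rw [hc, h2] at h1
  have h3 := congrArg (quatJ * ·) h1
  simp only [← mul_assoc, quatJ_mul_self, mul_zero] at h3
  simpa using h3.symm

/-- The Gram–Schmidt step: an anisotropic vector orthogonal to all f r exists by nondegeneracy, and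
`exists_conj_eq_quatJ` rescales it. -/
theorem exists_extension [Module.Finite ℍ[ℝ]ᵐᵒᵖ V] (hB : IsSkewHermitian B)
    (hnd : ∀ v, (∀ u, B v u = 0) → v = 0) {m : ℕ} {f : Fin m → V}
    (hf : ∀ r s, B (f r) (f s) = if r = s then quatJ else 0)
    (hm : m < Module.finrank ℍ[ℝ]ᵐᵒᵖ V) : ∃ v, (∀ r, B (f r) v = 0) ∧ B v v = quatJ := by
  let W : Submodule ℍ[ℝ]ᵐᵒᵖ V :=
    { carrier := {v | ∀ r, B (f r) v = 0}
      add_mem' := fun {a b} ha hb r => by rw [hB.add_right, ha, hb, add_zero]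
      zero_mem' := fun r => map_zero (AddMonoidHom.mk' (B (f r)) (hB.add_right (f r)))
      smul_mem' := fun c v hv r => by rw [← op_unop c, hB.smul_right, hv, zero_mul] }
  -- Projection onto the orthogonal complement W of the f s; the plus sign is due to j⁻¹ = -j.
  let p : V → V := fun v => v + ∑ s, op (quatJ * B (f s) v) • f s
  have hp : ∀ v, p v ∈ W := by
    intro v r
    rw [hB.add_right, hB.sum_right, Finset.sum_eq_single r]
    · rw [hB.smul_right, hf, if_pos rfl, ← mul_assoc, quatJ_mul_self, neg_one_mul, add_neg_cancel]
    · intro s _ hs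
      rw [hB.smul_right, hf, if_neg hs.symm, zero_mul]
    · simp
  obtain ⟨x, hx⟩ : ∃ x, p x ≠ 0 := by
    by_contra! h
    have h1 : Submodule.span ℍ[ℝ]ᵐᵒᵖ (Set.range f) = ⊤ := by
      rw [eq_top_iff]
      intro v _
      rw [← neg_mem_iff, neg_eq_of_add_eq_zero_right (h v)]
      exact sum_mem fun s _ => Submodule.smul_mem _ _ (Submodule.subset_span ⟨s, rfl⟩)
    have h2 := finrank_range_le_card (R := ℍ[ℝ]ᵐᵒᵖ) f
    rw [Set.finrank, h1, finrank_top, Fintype.card_fin] at h2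
    omega
  obtain ⟨y, hy⟩ : ∃ y, B (p x) y ≠ 0 := by
    by_contra! h
    exact hx (hnd _ h)
  have hy' : B (p x) (p y) ≠ 0 := by
    rw [hB.add_right, hB.sum_right, Finset.sum_eq_zero, add_zero]
    · exact hy
    · intro s _
      rw [hB.smul_right, hB.eq_neg_star, hp x s, star_zero, neg_zero, zero_mul]
  obtain ⟨v, hv, hv0⟩ := hB.exists_anisotropic W (hp x) (hp y) hy'
  obtain ⟨a, ha⟩ := exists_conj_eq_quatJ (hB.star_eq v v) hv0
  exact ⟨op a • v, W.smul_mem _ hv, by rw [hB.smul_right, hB.smul_left, ha]⟩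

/-- A nondegenerate skew-Hermitian form has a basis with Gram matrix `j`. -/
theorem exists_basis [Module.Finite ℍ[ℝ]ᵐᵒᵖ V] (hB : IsSkewHermitian B)
    (hnd : ∀ v, (∀ u, B v u = 0) → v = 0) {t : ℕ} (ht : t = Module.finrank ℍ[ℝ]ᵐᵒᵖ V) :
    ∃ b : Module.Basis (Fin t) ℍ[ℝ]ᵐᵒᵖ V, ∀ r s, B (b r) (b s) = skewMatrix t r s := by
  have key : ∀ m ≤ t, ∃ f : Fin m → V, ∀ r s, B (f r) (f s) = if r = s then quatJ else 0 := by
    intro m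
    induction m with
    | zero => exact fun _ => ⟨Fin.elim0, fun r => r.elim0⟩
    | succ m ih =>
      intro hm
      obtain ⟨f, hf⟩ := ih (by omega)
      obtain ⟨v, hv, hvv⟩ := hB.exists_extension hnd hf (by omega)
      refine ⟨Fin.snoc (α := fun _ => V) f v, fun r s => ?_⟩
      induction r using Fin.lastCases with
      | last =>
        induction s using Fin.lastCases with
        | last => simpa using hvv
        | cast s =>
          rw [hB.eq_neg_star]
          simp [hv, (Fin.castSucc_lt_last s).ne']
      | cast r =>
        induction s using Fin.lastCases with
        | last => simp [hv, (Fin.castSucc_lt_last r).ne]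
        | cast s => simp [hf]
  obtain ⟨f, hf⟩ := key t le_rfl
  refine ⟨basisOfLinearIndependentOfCardEqFinrank' f (hB.linearIndependent hf) (by simpa using ht),
    fun r s => ?_⟩
  rw [coe_basisOfLinearIndependentOfCardEqFinrank', hf, skewMatrix, Matrix.diagonal_apply]

end IsSkewHermitian

end SkewHermitian

/-! ### Independence of the invariants from the chosen triple -/

section Transfer

variable {n : ℕ}

theorem HasSignature.map {V W : Type} [AddCommGroup V] [Module ℍ[ℝ]ᵐᵒᵖ V] [AddCommGroup W]
    [Module ℍ[ℝ]ᵐᵒᵖ W] {B : V → V → ℍ[ℝ]} {B' : W → W → ℍ[ℝ]} {p q : ℕ} (hB : HasSignature B p q)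
    (e : V ≃ₗ[ℍ[ℝ]ᵐᵒᵖ] W) (he : ∀ v u, B' (e v) (e u) = B v u) : HasSignature B' p q := by
  obtain ⟨b, h1, h2, h3⟩ := hB
  exact ⟨b.map e, fun r s hrs => by simpa [he] using h1 r s hrs, by simpa [he] using h2,
    by simpa [he] using h3⟩

/-- The invariants of an orbit may be computed from any triple extending `X`. -/
theorem OrbitCorrespondsTo.invariants {X H Y : soStar n} {D : SignedYoungDiagram n}
    (hD : OrbitCorrespondsTo X D) (hT : IsSl2Triple H X Y) :
    (∀ d : ℕ, 1 ≤ d → D.mult d = Module.finrank ℍ[ℝ]ᵐᵒᵖ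
      (lowestWeightSpace (H : HMat (Fin n)) (Y : HMat (Fin n)) d)) ∧
    ∀ η ∈ D.evenParts, HasSignature
      (lowestWeightForm (X : HMat (Fin n)) (H : HMat (Fin n)) (Y : HMat (Fin n)) η)
        (D.posCount η) (D.negCount η) := by
  obtain ⟨X', H', Y', ⟨g, hg, hX'⟩, hT', h1, -, h3⟩ := hD
  have r' := sl2Rel_of_isSl2Triple hT'
  have key : ∀ d : ℕ, 1 ≤ d → ∃ e : lowestWeightSpace (H' : HMat (Fin n)) (Y' : HMat (Fin n)) d
      ≃ₗ[ℍ[ℝ]ᵐᵒᵖ] lowestWeightSpace (H : HMat (Fin n)) (Y : HMat (Fin n)) d, ∀ v u,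
      lowestWeightForm (X : HMat (Fin n)) H Y d (e v) (e u) =
        lowestWeightForm (X' : HMat (Fin n)) H' Y' d v u := by
    intro d hd
    -- Conjugation by g⁻¹ carries X' to X, so the conjugated triple and the given one share X and
    -- differ only in H and Y.
    let c : HMat (Fin n) →+* HMat (Fin n) :=
      { toFun := fun Z => (g⁻¹ : (HMat (Fin n))ˣ) * Z * g
        map_one' := by simp
        map_mul' := fun A B => by simp only [mul_assoc, Units.mul_inv_cancel_left]
        map_zero' := by simp
        map_add' := fun A B => by simp only [mul_add, add_mul] }
    have hc : ∀ Z, Z * (g : HMat (Fin n)) = g * c Z := fun Z => by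
      change _ = (g : HMat (Fin n)) * ((g⁻¹ : (HMat (Fin n))ˣ) * Z * g)
      simp only [mul_assoc, Units.mul_inv_cancel_left]
    have hX : (X' : HMat (Fin n)) * g = g * X := by
      rw [hX', mul_assoc, Units.inv_mul, mul_one]
    have hcX : c X' = X := by
      rw [← Units.mul_right_inj g, ← hc, hX]
    obtain ⟨e₁, he₁⟩ := exists_isometry_conj hg d hX (hc H') (hc Y')
    have r'' := r'.map c
    rw [hcX] at r''
    obtain ⟨e₂, he₂⟩ := exists_isometry_lowestWeightSpace X.2
      ((sl2Rel_of_isSl2Triple hT).map realAction) (r''.map realAction) hd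
    exact ⟨e₁.trans e₂, fun v u => by
      rw [LinearEquiv.trans_apply, LinearEquiv.trans_apply, he₂, he₁]⟩
  refine ⟨fun d hd => ?_, fun η hη => ?_⟩
  · obtain ⟨e, -⟩ := key d hd
    rw [h1 d hd, e.finrank_eq]
  · obtain ⟨e, he⟩ := key η (Nat.pos_of_ne_zero (by
      rintro rfl
      exact absurd (D.part.parts_pos hη.1) (lt_irrefl 0)))
    exact (h3 η hη).map e he

end Transfer

/-! ### The centralizer of a triple -/

section Centralizer

open MulOpposite

variable {n : ℕ} {X H Y : HMat (Fin n)}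

/-- With j = d - 1 and j' = d' - 1: skewness of H forces the weights -j and 2m - j' to cancel, so 2m
= j + j'. But X^m kills v for m > j', and, moved to the other side, kills u for m > j. Hence a
nonzero value needs m = j = j'. -/
theorem skewForm_lowest_eq_zero (hX : X ∈ soStar n) (hH : H ∈ soStar n) (r : Sl2Rel X H Y)
    {d d' m : ℕ} (hd : 1 ≤ d) (hd' : 1 ≤ d') {u v : Fin n → ℍ[ℝ]} (hu : u ∈ lowestWeightSpace H Y d)
    (hv : v ∈ lowestWeightSpace H Y d') (hm : ¬ (d = d' ∧ m + 1 = d)) :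
    skewForm u ((X ^ m) *ᵥ v) = 0 := by
  obtain ⟨j, rfl⟩ := Nat.exists_eq_add_of_le' hd
  obtain ⟨j', rfl⟩ := Nat.exists_eq_add_of_le' hd'
  have r' := r.map realAction
  by_cases h1 : j' < m
  · rw [X_pow_mulVec_lowest r' hv h1, skewForm_zero_right]
  by_cases h2 : j < m
  · have h := skewForm_lie_pow hX m u v
    rw [X_pow_mulVec_lowest r' hu h2, skewForm_zero_left] at h
    exact (smul_eq_zero.1 h.symm).resolve_left (by simp)
  have h3 := skewForm_lie hH u ((X ^ m) *ᵥ v)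
  have h4 := r'.h_x_pow (mem_lowestWeightSpace_succ.1 hv) m
  rw [realAction_pow_apply, realAction_apply] at h4
  rw [(mem_lowestWeightSpace_iff.1 hu).2, h4, skewForm_real_smul_left, skewForm_real_smul_right,
    ← neg_smul, ← sub_eq_zero, ← sub_smul] at h3
  refine (smul_eq_zero.1 h3).resolve_left fun h5 => ?_
  have h6 : (2 * m : ℝ) = j + j' := by
    push_cast at h5
    linarith
  have h7 : 2 * m = j + j' := by exact_mod_cast h6
  omega

/-- Bases of all the nonzero spaces of lowest weight vectors of a triple. -/
structure LowestWeightBases (X H Y : HMat (Fin n)) (Δ : Type) [Fintype Δ] (ι : Δ → Type)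
    [∀ δ, Fintype (ι δ)] where
  rel : Sl2Rel X H Y
  memX : X ∈ soStar n
  memH : H ∈ soStar n
  deg : Δ → ℕ
  deg_pos : ∀ δ, 1 ≤ deg δ
  deg_injective : Function.Injective deg
  basis : ∀ δ, Module.Basis (ι δ) ℍ[ℝ]ᵐᵒᵖ (lowestWeightSpace H Y (deg δ))
  eq_bot : ∀ d, 1 ≤ d → d ∉ Set.range deg → lowestWeightSpace H Y d = ⊥
  card_eq : ∑ δ, Fintype.card (ι δ) * deg δ = n

namespace LowestWeightBases

variable {Δ : Type} [Fintype Δ] {ι : Δ → Type} [∀ δ, Fintype (ι δ)]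
  (b : LowestWeightBases X H Y Δ ι)

/-- The vectors `X ^ k b_i`, for a basis `b_i` of a space of lowest weight vectors. -/
def vec (δ : Δ) (i : ι δ) (k : ℕ) : Fin n → ℍ[ℝ] :=
  (X ^ k) *ᵥ (b.basis δ i : Fin n → ℍ[ℝ])

theorem mem_lowest (δ : Δ) (i : ι δ) : (b.basis δ i : Fin n → ℍ[ℝ]) ∈
    Sl2Rel.lowest (realAction H) (realAction Y) (b.deg δ - 1) := by
  have h : ∀ d, 1 ≤ d → ∀ v : lowestWeightSpace H Y d,
      (v : Fin n → ℍ[ℝ]) ∈ Sl2Rel.lowest (realAction H) (realAction Y) (d - 1) := by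
    intro d hd v
    obtain ⟨j, rfl⟩ := Nat.exists_eq_add_of_le' hd
    exact mem_lowestWeightSpace_succ.1 v.2
  exact h _ (b.deg_pos δ) _

theorem vec_eq_zero {δ : Δ} (i : ι δ) {k : ℕ} (hk : b.deg δ ≤ k) : b.vec δ i k = 0 := by
  rw [vec, ← realAction_pow_apply]
  refine (b.rel.map realAction).x_pow_eq_zero (b.mem_lowest δ i) ?_
  have := b.deg_pos δ
  omega

theorem X_vec (δ : Δ) (i : ι δ) (k : ℕ) : X *ᵥ b.vec δ i k = b.vec δ i (k + 1) := by
  rw [vec, vec, Matrix.mulVec_mulVec, ← pow_succ']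

theorem H_vec (δ : Δ) (k : ℕ) : ∃ c : ℝ, ∀ i, H *ᵥ b.vec δ i k = c • b.vec δ i k := by
  refine ⟨2 * k - (b.deg δ - 1 : ℕ), fun i => ?_⟩
  have h := (b.rel.map realAction).h_x_pow (b.mem_lowest δ i) k
  rw [realAction_pow_apply, realAction_apply] at h
  exact h

theorem Y_vec_zero (δ : Δ) (i : ι δ) : Y *ᵥ b.vec δ i 0 = 0 := by
  rw [vec, pow_zero, Matrix.one_mulVec]
  exact (b.basis δ i).2.1

theorem Y_vec_succ (δ : Δ) (k : ℕ) :
    ∃ c : ℝ, ∀ i, Y *ᵥ b.vec δ i (k + 1) = c • b.vec δ i k := by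
  refine ⟨(k + 1) * ((b.deg δ - 1 : ℕ) - k), fun i => ?_⟩
  have h := (b.rel.map realAction).y_x_pow (b.mem_lowest δ i) k
  rw [realAction_pow_apply, realAction_pow_apply, realAction_apply] at h
  exact h

/-- The Gram matrix of the form on a space of lowest weight vectors. -/
def gram (δ : Δ) : HMat (ι δ) :=
  Matrix.of fun i i' => lowestWeightForm X H Y (b.deg δ) (b.basis δ i) (b.basis δ i')

theorem skewForm_vec_of_ne {δ δ' : Δ} (h : δ ≠ δ') (i : ι δ) (i' : ι δ') (k k' : ℕ) :
    skewForm (b.vec δ i k) (b.vec δ' i' k') = 0 := by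
  rw [vec, vec, skewForm_lie_pow b.memX, Matrix.mulVec_mulVec, ← pow_add,
    skewForm_lowest_eq_zero b.memX b.memH b.rel (b.deg_pos δ) (b.deg_pos δ') (b.basis δ i).2
      (b.basis δ' i').2 (fun h' => h (b.deg_injective h'.1)), smul_zero]

theorem skewForm_vec (δ : Δ) (i i' : ι δ) (k k' : ℕ) : skewForm (b.vec δ i k) (b.vec δ i' k') =
    (if k + k' + 1 = b.deg δ then (-1 : ℝ) ^ k else 0) • b.gram δ i i' := by
  rw [vec, vec, skewForm_lie_pow b.memX, Matrix.mulVec_mulVec, ← pow_add]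
  split_ifs with h
  · have h' : b.deg δ - 1 = k + k' := by omega
    rw [gram, Matrix.of_apply, lowestWeightForm, h']
  · rw [skewForm_lowest_eq_zero b.memX b.memH b.rel (b.deg_pos δ) (b.deg_pos δ) (b.basis δ i).2
      (b.basis δ i').2 (fun h' => h h'.2), smul_zero, zero_smul]

theorem sum_repr_coe (δ : Δ) {v : Fin n → ℍ[ℝ]} (hv : v ∈ lowestWeightSpace H Y (b.deg δ)) :
    ∑ i, (b.basis δ).repr ⟨v, hv⟩ i • (b.basis δ i : Fin n → ℍ[ℝ]) = v := by
  have h := congrArg Subtype.val ((b.basis δ).sum_repr ⟨v, hv⟩)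
  rw [Submodule.coe_sum] at h
  exact h

/-- The vectors `X ^ k b_i` span the space of columns. -/
theorem span_vec : Submodule.span ℍ[ℝ]ᵐᵒᵖ
    (Set.range fun κ : Σ δ, ι δ × Fin (b.deg δ) => b.vec κ.1 κ.2.1 κ.2.2) = ⊤ := by
  set S := Submodule.span ℍ[ℝ]ᵐᵒᵖ
    (Set.range fun κ : Σ δ, ι δ × Fin (b.deg δ) => b.vec κ.1 κ.2.1 κ.2.2)
  have hvec : ∀ δ i k, b.vec δ i k ∈ S := by
    intro δ i k
    by_cases hk : k < b.deg δ
    · exact Submodule.subset_span ⟨⟨δ, i, ⟨k, hk⟩⟩, rfl⟩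
    · rw [b.vec_eq_zero i (not_lt.1 hk)]
      exact zero_mem S
  have h1 : S.restrictScalars ℝ = ⊤ := by
    refine (b.rel.map realAction).eq_top_of_strings _ fun j k v hv => ?_
    rw [← mem_lowestWeightSpace_succ] at hv
    rw [realAction_pow_apply]
    by_cases hj : j + 1 ∈ Set.range b.deg
    · obtain ⟨δ, hδ⟩ := hj
      rw [← hδ] at hv
      rw [← b.sum_repr_coe δ hv, Matrix.mulVec_sum]
      simp only [Matrix.mulVec_smul]
      exact sum_mem fun i _ => S.smul_mem _ (hvec δ i k)
    · rw [b.eq_bot _ (Nat.le_add_left 1 j) hj, Submodule.mem_bot] at hv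
      rw [hv, Matrix.mulVec_zero]
      exact zero_mem _
  exact (Submodule.restrictScalars_eq_top_iff ℝ _ _).1 h1

/-- The basis `X ^ k b_i` of the space of columns. -/
def stringBasis : Module.Basis (Σ δ, ι δ × Fin (b.deg δ)) ℍ[ℝ]ᵐᵒᵖ (Fin n → ℍ[ℝ]) :=
  -- Linear independence comes from spanning and the count Σ t_d d = n in `card_eq`.
  basisOfTopLeSpanOfCardEqFinrank (fun κ : Σ δ, ι δ × Fin (b.deg δ) => b.vec κ.1 κ.2.1 κ.2.2)
    b.span_vec.ge (by simp [Fintype.card_sigma, finrank_columns, b.card_eq])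

theorem stringBasis_apply (κ : Σ δ, ι δ × Fin (b.deg δ)) :
    b.stringBasis κ = b.vec κ.1 κ.2.1 κ.2.2 := by
  rw [stringBasis, coe_basisOfTopLeSpanOfCardEqFinrank]

/-- The matrix with the columns `X ^ k b_i`. -/
def toStd : Matrix (Fin n) (Σ δ, ι δ × Fin (b.deg δ)) ℍ[ℝ] :=
  Matrix.of fun a κ => b.vec κ.1 κ.2.1 κ.2.2 a

/-- The inverse of the matrix `toStd`. -/
def ofStd : Matrix (Σ δ, ι δ × Fin (b.deg δ)) (Fin n) ℍ[ℝ] :=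
  Matrix.of fun κ a => unop (b.stringBasis.repr (Pi.single a 1) κ)

theorem toStd_mul_ofStd : b.toStd * b.ofStd = 1 := by
  ext1 a c
  have h := congrFun (b.stringBasis.sum_repr (Pi.single c 1)) a
  simp only [Finset.sum_apply, Pi.smul_apply, stringBasis_apply] at h
  simpa [Matrix.mul_apply, toStd, ofStd, Matrix.one_apply, Pi.single_apply] using h

theorem mul_toStd_apply (M : HMat (Fin n)) (a : Fin n) (κ : Σ δ, ι δ × Fin (b.deg δ)) :
    (M * b.toStd) a κ = (M *ᵥ b.vec κ.1 κ.2.1 κ.2.2) a := rfl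

theorem isometry_iff_vec (M : HMat (Fin n)) : Mᴴ * skewMatrix n * M = skewMatrix n ↔
    ∀ δ i k δ' i' k', skewForm (M *ᵥ b.vec δ i k) (M *ᵥ b.vec δ' i' k') =
      skewForm (b.vec δ i k) (b.vec δ' i' k') := by
  have h0 : ∀ v u, skewForm (M *ᵥ v) (M *ᵥ u) = star v ⬝ᵥ ((Mᴴ * skewMatrix n * M) *ᵥ u) :=
    fun v u => by rw [skewForm_mulVec_left, Matrix.mulVec_mulVec]
  refine ⟨fun h δ i k δ' i' k' => by rw [h0, h, skewForm], fun h => ?_⟩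
  have h1 : b.toStdᴴ * ((Mᴴ * skewMatrix n * M) * b.toStd) =
      b.toStdᴴ * (skewMatrix n * b.toStd) := by
    ext1 κ κ'
    have := h κ.1 κ.2.1 κ.2.2 κ'.1 κ'.2.1 κ'.2.2
    rw [h0, skewForm] at this
    exact this
  have h2 : b.ofStdᴴ * b.toStdᴴ = 1 := by
    rw [← Matrix.conjTranspose_mul, b.toStd_mul_ofStd, Matrix.conjTranspose_one]
  have h3 := congrArg (fun N => b.ofStdᴴ * N * b.ofStd) h1
  simpa only [← Matrix.mul_assoc, h2, Matrix.one_mul, Matrix.mul_assoc _ b.toStd b.ofStd,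
    b.toStd_mul_ofStd, Matrix.mul_one] using h3

theorem ext_vec {M N : HMat (Fin n)}
    (h : ∀ δ i k, k < b.deg δ → M *ᵥ b.vec δ i k = N *ᵥ b.vec δ i k) : M = N := by
  have h1 : M * b.toStd = N * b.toStd := by
    ext1 a κ
    rw [mul_toStd_apply, mul_toStd_apply, h _ _ _ κ.2.2.2]
  have h2 := congrArg (· * b.ofStd) h1
  simpa only [Matrix.mul_assoc, b.toStd_mul_ofStd, Matrix.mul_one] using h2

/-- The diagonal blocks of a matrix acting on the spaces of lowest weight vectors. -/
def corner (M : HMat (Fin n)) (δ : Δ) : HMat (ι δ) :=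
  Matrix.of fun i i' => (b.ofStd * M * b.toStd) ⟨δ, i, ⟨0, b.deg_pos δ⟩⟩ ⟨δ, i', ⟨0, b.deg_pos δ⟩⟩

theorem continuous_corner (δ : Δ) : Continuous fun M => b.corner M δ := by
  refine continuous_matrix fun i i' => ?_
  exact (Continuous.matrix_mul (continuous_const.matrix_mul continuous_id)
    continuous_const).matrix_elem _ _

variable [DecidableEq Δ] [∀ δ, DecidableEq (ι δ)]

/-- The two index types differ, so the left inverse is derived separately: the columns of `toStd`
are linearly independent, hence `toStd` can be cancelled on the left. -/
theorem ofStd_mul_toStd : b.ofStd * b.toStd = 1 := by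
  have h : b.toStd * (b.ofStd * b.toStd - 1) = 0 := by
    rw [Matrix.mul_sub, ← Matrix.mul_assoc, b.toStd_mul_ofStd, Matrix.one_mul, Matrix.mul_one,
      sub_self]
  rw [← sub_eq_zero]
  generalize b.ofStd * b.toStd - 1 = M at h
  ext1 κ κ'
  have h1 : ∑ l, op (M l κ') • b.stringBasis l = 0 := by
    funext a
    have := congrFun (congrFun h a) κ'
    simpa [Matrix.mul_apply, toStd, stringBasis_apply] using this
  have h2 := Fintype.linearIndependent_iff.1 b.stringBasis.linearIndependent _ h1 κ
  simpa using h2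

/-- The block diagonal matrices that act in the same way on `X ^ k L` for all `k`. -/
def blocks (A : ∀ δ, HMat (ι δ)) : HMat (Σ δ, ι δ × Fin (b.deg δ)) :=
  Matrix.blockDiagonal' fun δ => Matrix.blockDiagonal fun _ : Fin (b.deg δ) => A δ

/-- The matrix acting on all `X ^ k L(d-1)` by the given matrix of size `dim L(d-1)`. -/
def assemble : (∀ δ, HMat (ι δ)) →* HMat (Fin n) where
  toFun A := b.toStd * b.blocks A * b.ofStd
  map_one' := by
    have : b.blocks 1 = 1 := by
      simp only [blocks, Pi.one_apply]
      rw [← Matrix.blockDiagonal'_one]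
      congr 1
      funext δ
      exact Matrix.blockDiagonal_one
    rw [this, Matrix.mul_one, b.toStd_mul_ofStd]
  map_mul' A B := by
    have : b.blocks (A * B) = b.blocks A * b.blocks B := by
      simp only [blocks, Pi.mul_apply]
      rw [← Matrix.blockDiagonal'_mul]
      congr 1
      funext δ
      exact Matrix.blockDiagonal_mul _ _
    rw [this]
    simp only [Matrix.mul_assoc]
    rw [← Matrix.mul_assoc b.ofStd, b.ofStd_mul_toStd, Matrix.one_mul]

theorem assemble_apply (A : ∀ δ, HMat (ι δ)) :
    b.assemble A = b.toStd * b.blocks A * b.ofStd := rfl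

theorem assemble_vec (A : ∀ δ, HMat (ι δ)) (δ : Δ) (i : ι δ) (k : ℕ) :
    b.assemble A *ᵥ b.vec δ i k = ∑ i', op (A δ i' i) • b.vec δ i' k := by
  by_cases hk : k < b.deg δ
  · funext a
    have h1 : b.assemble A * b.toStd = b.toStd * b.blocks A := by
      rw [assemble_apply, Matrix.mul_assoc, b.ofStd_mul_toStd, Matrix.mul_one]
    have h2 := congrFun (congrFun h1 a) ⟨δ, i, ⟨k, hk⟩⟩
    rw [mul_toStd_apply] at h2
    rw [h2, Matrix.mul_apply, Fintype.sum_sigma, Finset.sum_eq_single δ]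
    · rw [Fintype.sum_prod_type]
      simp [blocks, Matrix.blockDiagonal'_apply, Matrix.blockDiagonal_apply, toStd]
    · intro δ' _ hδ
      simp [blocks, Matrix.blockDiagonal'_apply, hδ]
    · simp
  · rw [b.vec_eq_zero i (not_lt.1 hk), Matrix.mulVec_zero, eq_comm]
    exact Finset.sum_eq_zero fun i' _ => by rw [b.vec_eq_zero i' (not_lt.1 hk), smul_zero]

theorem assemble_commute_X (A : ∀ δ, HMat (ι δ)) : Commute (b.assemble A) X := by
  refine b.ext_vec fun δ i k _ => ?_
  rw [← Matrix.mulVec_mulVec, ← Matrix.mulVec_mulVec, X_vec, assemble_vec, assemble_vec,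
    Matrix.mulVec_sum]
  simp only [Matrix.mulVec_smul, X_vec]

theorem assemble_commute_H (A : ∀ δ, HMat (ι δ)) : Commute (b.assemble A) H := by
  refine b.ext_vec fun δ i k _ => ?_
  obtain ⟨c, hc⟩ := b.H_vec δ k
  rw [← Matrix.mulVec_mulVec, ← Matrix.mulVec_mulVec, hc, Matrix.mulVec_smul, assemble_vec,
    Matrix.mulVec_sum, Finset.smul_sum]
  exact Finset.sum_congr rfl fun i' _ => by rw [Matrix.mulVec_smul, hc, smul_comm]

theorem assemble_commute_Y (A : ∀ δ, HMat (ι δ)) : Commute (b.assemble A) Y := by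
  refine b.ext_vec fun δ i k _ => ?_
  rw [← Matrix.mulVec_mulVec, ← Matrix.mulVec_mulVec, assemble_vec, Matrix.mulVec_sum]
  cases k with
  | zero =>
    rw [Y_vec_zero, Matrix.mulVec_zero, eq_comm]
    exact Finset.sum_eq_zero fun i' _ => by rw [Matrix.mulVec_smul, Y_vec_zero, smul_zero]
  | succ k =>
    obtain ⟨c, hc⟩ := b.Y_vec_succ δ k
    rw [hc, Matrix.mulVec_smul, assemble_vec, Finset.smul_sum]
    exact Finset.sum_congr rfl fun i' _ => by rw [Matrix.mulVec_smul, hc, smul_comm]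

theorem corner_assemble (A : ∀ δ, HMat (ι δ)) : b.corner (b.assemble A) = A := by
  funext δ
  ext1 i i'
  rw [corner, Matrix.of_apply, assemble_apply, Matrix.mul_assoc, Matrix.mul_assoc,
    b.ofStd_mul_toStd, Matrix.mul_one, ← Matrix.mul_assoc, b.ofStd_mul_toStd, Matrix.one_mul]
  simp [blocks, Matrix.blockDiagonal'_apply, Matrix.blockDiagonal_apply]

theorem ofStd_mulVec_vec (κ κ' : Σ δ, ι δ × Fin (b.deg δ)) :
    (b.ofStd *ᵥ b.vec κ'.1 κ'.2.1 κ'.2.2) κ = if κ = κ' then 1 else 0 := by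
  have h := congrFun (congrFun b.ofStd_mul_toStd κ) κ'
  rw [Matrix.one_apply] at h
  exact h

/-- Commuting with H and Y keeps each L(d-1) stable, and commuting with X propagates the action on
L(d-1) along the strings. -/
theorem assemble_corner {M : HMat (Fin n)} (hX : Commute M X) (hH : Commute M H)
    (hY : Commute M Y) : b.assemble (b.corner M) = M := by
  refine b.ext_vec fun δ i k _ => ?_
  rw [assemble_vec]
  have hmem : M *ᵥ (b.basis δ i : Fin n → ℍ[ℝ]) ∈ lowestWeightSpace H Y (b.deg δ) := by
    obtain ⟨h1, h2⟩ := (b.basis δ i).2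
    refine ⟨?_, ?_⟩
    · rw [Matrix.mulVec_mulVec, ← hY.eq, ← Matrix.mulVec_mulVec, h1, Matrix.mulVec_zero]
    · rw [Matrix.mulVec_mulVec, ← hH.eq, ← Matrix.mulVec_mulVec, h2, Matrix.mulVec_smul]
  set c := (b.basis δ).repr ⟨_, hmem⟩
  have hc : M *ᵥ (b.basis δ i : Fin n → ℍ[ℝ]) = ∑ i', c i' • (b.basis δ i' : Fin n → ℍ[ℝ]) :=
    (b.sum_repr_coe δ hmem).symm
  have hcorner : ∀ i', op (b.corner M δ i' i) = c i' := by
    intro i'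
    have h0 : ∀ l, (b.basis δ l : Fin n → ℍ[ℝ]) = b.vec δ l 0 := fun l => by
      rw [vec, pow_zero, Matrix.one_mulVec]
    have h1 : b.corner M δ i' i =
        (b.ofStd *ᵥ (M *ᵥ b.vec δ i 0)) ⟨δ, i', ⟨0, b.deg_pos δ⟩⟩ := by
      rw [Matrix.mulVec_mulVec]
      rfl
    rw [h1, ← h0, hc, Matrix.mulVec_sum, Finset.sum_apply, Finset.sum_eq_single i']
    · rw [Matrix.mulVec_smul, h0, Pi.smul_apply,
        b.ofStd_mulVec_vec ⟨δ, i', ⟨0, b.deg_pos δ⟩⟩ ⟨δ, i', ⟨0, b.deg_pos δ⟩⟩, if_pos rfl]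
      rw [← op_unop (c i'), op_smul_eq_mul, one_mul]
    · intro l _ hl
      rw [Matrix.mulVec_smul, h0, Pi.smul_apply,
        b.ofStd_mulVec_vec ⟨δ, i', ⟨0, b.deg_pos δ⟩⟩ ⟨δ, l, ⟨0, b.deg_pos δ⟩⟩, if_neg, smul_zero]
      simpa using hl.symm
    · simp
  simp only [hcorner]
  rw [vec, Matrix.mulVec_mulVec, (hX.pow_right k).eq, ← Matrix.mulVec_mulVec, hc,
    Matrix.mulVec_sum]
  simp only [Matrix.mulVec_smul, vec]

theorem skewForm_assemble_vec (A : ∀ δ, HMat (ι δ)) (δ : Δ) (i i' : ι δ) (k k' : ℕ) :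
    skewForm (b.assemble A *ᵥ b.vec δ i k) (b.assemble A *ᵥ b.vec δ i' k') =
      (if k + k' + 1 = b.deg δ then (-1 : ℝ) ^ k else 0) •
        ((A δ)ᴴ * b.gram δ * A δ) i i' := by
  rw [assemble_vec, assemble_vec, skewForm_sum_right, Matrix.mul_apply, Finset.smul_sum]
  refine Finset.sum_congr rfl fun l _ => ?_
  rw [skewForm_sum_left, Matrix.mul_apply, Finset.sum_mul, Finset.smul_sum]
  refine Finset.sum_congr rfl fun l' _ => ?_
  rw [skewForm_smul_left, skewForm_smul_right, skewForm_vec, Matrix.conjTranspose_apply,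
    smul_mul_assoc, mul_smul_comm, mul_assoc]

theorem skewForm_assemble_vec_of_ne (A : ∀ δ, HMat (ι δ)) {δ δ' : Δ} (h : δ ≠ δ') (i : ι δ)
    (i' : ι δ') (k k' : ℕ) :
    skewForm (b.assemble A *ᵥ b.vec δ i k) (b.assemble A *ᵥ b.vec δ' i' k') = 0 := by
  rw [assemble_vec, assemble_vec, skewForm_sum_right]
  refine Finset.sum_eq_zero fun l _ => ?_
  rw [skewForm_sum_left]
  refine Finset.sum_eq_zero fun l' _ => ?_
  rw [skewForm_smul_left, skewForm_smul_right, b.skewForm_vec_of_ne h, zero_mul, mul_zero]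

/-- All nonzero pairings between strings are signs times Gram entries on a single L(d-1), so
preserving these Gram matrices suffices. -/
theorem assemble_isometry_iff (A : ∀ δ, HMat (ι δ)) :
    (b.assemble A)ᴴ * skewMatrix n * b.assemble A = skewMatrix n ↔
      ∀ δ, (A δ)ᴴ * b.gram δ * A δ = b.gram δ := by
  rw [b.isometry_iff_vec]
  constructor
  · intro h δ
    ext1 i i'
    -- Pairing the bottom of one string with the top of another gives the Gram matrix with sign +1.
    have h1 := h δ i 0 δ i' (b.deg δ - 1)
    have h2 : 0 + (b.deg δ - 1) + 1 = b.deg δ := by have := b.deg_pos δ; omega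
    rw [skewForm_assemble_vec, skewForm_vec, if_pos h2, pow_zero, one_smul, one_smul] at h1
    exact h1
  · intro h δ i k δ' i' k'
    rcases eq_or_ne δ δ' with rfl | hδ
    · rw [skewForm_assemble_vec, skewForm_vec, h]
    · rw [b.skewForm_assemble_vec_of_ne A hδ, b.skewForm_vec_of_ne hδ]

end LowestWeightBases

end Centralizer

/-! ### Continuity of homomorphisms into groups of units -/

section Topology

/-- A homomorphism from a topological group to a group of units is continuous if its values are. -/
theorem continuous_toUnits {G M : Type} [Group G] [TopologicalSpace G] [IsTopologicalGroup G]
    [Monoid M] [TopologicalSpace M] (f : G →* Mˣ) (hf : Continuous fun g => (f g : M)) :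
    Continuous f := by
  refine Units.continuous_iff.2 ⟨hf, ?_⟩
  have : (fun g => (((f g)⁻¹ : Mˣ) : M)) = fun g => (f g⁻¹ : M) := by
    funext g
    rw [map_inv]
  exact this ▸ hf.comp continuous_inv

end Topology

/-! ### The centralizer as a product of isometry groups, topologically -/

section Centralizer

variable {n : ℕ} {X H Y : HMat (Fin n)}

theorem mem_adCentralizer_iff {ι : Type} [Fintype ι] [DecidableEq ι] {G : Subgroup (HMat ι)ˣ}
    {S : Set (HMat ι)} {g : (HMat ι)ˣ} :
    g ∈ adCentralizer G S ↔ g ∈ G ∧ ∀ Z ∈ S, Commute (g : HMat ι) Z :=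
  and_congr_right fun _ => forall₂_congr fun _ _ => Units.mul_inv_eq_iff_eq_mul g

namespace LowestWeightBases

variable {Δ : Type} [Fintype Δ] [DecidableEq Δ] {ι : Δ → Type} [∀ δ, Fintype (ι δ)]
  [∀ δ, DecidableEq (ι δ)] (b : LowestWeightBases X H Y Δ ι)

/-- Assembling invertible matrices. -/
def assembleUnits : (∀ δ, quatIsometry (b.gram δ)) →* (HMat (Fin n))ˣ :=
  (Units.map b.assemble).comp ((MulEquiv.piUnits.symm.toMonoidHom).comp
    (MonoidHom.pi fun δ => (quatIsometry (b.gram δ)).subtype.comp (Pi.evalMonoidHom _ δ)))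

theorem assembleUnits_val (A : ∀ δ, quatIsometry (b.gram δ)) :
    (b.assembleUnits A : HMat (Fin n)) = b.assemble fun δ => ((A δ : (HMat (ι δ))ˣ) : HMat (ι δ)) :=
  rfl

theorem continuous_assembleUnits : Continuous b.assembleUnits := by
  refine continuous_toUnits _ ?_
  simp only [assembleUnits_val, assemble_apply, blocks]
  refine Continuous.matrix_mul (Continuous.matrix_mul continuous_const ?_) continuous_const
  refine Continuous.matrix_blockDiagonal' (continuous_pi fun δ => ?_)
  refine Continuous.matrix_blockDiagonal (continuous_pi fun _ => ?_)
  exact Units.continuous_val.comp (continuous_subtype_val.comp (continuous_apply δ))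

theorem assembleUnits_mem (A : ∀ δ, quatIsometry (b.gram δ)) :
    b.assembleUnits A ∈ adCentralizer (SOStar n) {X, H, Y} := by
  refine mem_adCentralizer_iff.2 ⟨?_, ?_⟩
  · rw [SOStar_eq]
    exact (b.assemble_isometry_iff _).2 fun δ => (A δ).2
  · rintro Z (rfl | rfl | rfl)
    · exact b.assemble_commute_X _
    · exact b.assemble_commute_H _
    · exact b.assemble_commute_Y _

theorem exists_assembleUnits {g : (HMat (Fin n))ˣ}
    (hg : g ∈ adCentralizer (SOStar n) {X, H, Y}) : ∃ A, b.assembleUnits A = g := by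
  have h1 : ∀ {g : (HMat (Fin n))ˣ}, g ∈ adCentralizer (SOStar n) {X, H, Y} →
      b.assemble (b.corner g) = g := fun hg => by
    have h := (mem_adCentralizer_iff.1 hg).2
    exact b.assemble_corner (h X (by simp)) (h H (by simp)) (h Y (by simp))
  -- On the centralizer `corner` is inverse to the homomorphism `assemble`, hence multiplicative; so
  -- the corners of g and g⁻¹ are mutually inverse.
  have h2 : ∀ {g : (HMat (Fin n))ˣ}, g ∈ adCentralizer (SOStar n) {X, H, Y} → ∀ δ,
      b.corner g δ * b.corner (g⁻¹ : (HMat (Fin n))ˣ) δ = 1 := fun {g} hg δ => by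
    have h3 := b.corner_assemble (b.corner g * b.corner (g⁻¹ : (HMat (Fin n))ˣ))
    rw [map_mul, h1 hg, h1 (inv_mem hg), Units.mul_inv, ← map_one b.assemble,
      corner_assemble] at h3
    exact (congrFun h3 δ).symm
  refine ⟨fun δ => ⟨⟨b.corner g δ, b.corner (g⁻¹ : (HMat (Fin n))ˣ) δ, h2 hg δ, ?_⟩, ?_⟩, ?_⟩
  · have := h2 (inv_mem hg) δ
    rwa [inv_inv] at this
  · have h3 : g ∈ quatIsometry (skewMatrix n) := by
      rw [← SOStar_eq]
      exact (mem_adCentralizer_iff.1 hg).1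
    refine (b.assemble_isometry_iff (b.corner g)).1 ?_ δ
    rw [h1 hg]
    exact h3
  · exact Units.ext (h1 hg)

/-- `assembleUnits` as an isomorphism onto the centralizer. -/
def assembleEquiv :
    (∀ δ, quatIsometry (b.gram δ)) ≃* adCentralizer (SOStar n) {X, H, Y} :=
  MulEquiv.ofBijective (b.assembleUnits.codRestrict _ b.assembleUnits_mem)
    ⟨fun A B hAB => by
      have h := congrArg (fun g : adCentralizer (SOStar n) {X, H, Y} =>
        b.corner ((g : (HMat (Fin n))ˣ) : HMat (Fin n))) hAB
      funext δ
      refine Subtype.ext (Units.ext ?_)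
      have h' := congrFun h δ
      simpa only [MonoidHom.codRestrict_apply, assembleUnits_val, corner_assemble] using h',
    fun g => by
      obtain ⟨A, hA⟩ := b.exists_assembleUnits g.2
      exact ⟨A, Subtype.ext hA⟩⟩

theorem assembleEquiv_val (A : ∀ δ, quatIsometry (b.gram δ)) :
    (b.assembleEquiv A : (HMat (Fin n))ˣ) = b.assembleUnits A := rfl

theorem assembleEquiv_symm_val (g : adCentralizer (SOStar n) {X, H, Y}) (δ : Δ) :
    ((b.assembleEquiv.symm g δ : (HMat (ι δ))ˣ) : HMat (ι δ)) =
      b.corner ((g : (HMat (Fin n))ˣ) : HMat (Fin n)) δ := by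
  obtain ⟨A, rfl⟩ := b.assembleEquiv.surjective g
  rw [MulEquiv.symm_apply_apply, assembleEquiv_val, assembleUnits_val, corner_assemble]

theorem continuous_assembleEquiv_symm : Continuous b.assembleEquiv.symm := by
  refine continuous_pi fun δ => continuous_induced_rng.2 ?_
  refine continuous_toUnits ((quatIsometry (b.gram δ)).subtype.comp
    ((Pi.evalMonoidHom _ δ).comp b.assembleEquiv.symm.toMonoidHom)) ?_
  exact ((b.continuous_corner δ).comp (Units.continuous_val.comp continuous_subtype_val)).congr
    fun g => (b.assembleEquiv_symm_val g δ).symm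

/-- The centralizer of a triple is the product of the isometry groups of the forms on the spaces
of lowest weight vectors. -/
def centralizerEquiv :
    adCentralizer (SOStar n) {X, H, Y} ≃ₜ* ∀ δ, quatIsometry (b.gram δ) where
  toMulEquiv := b.assembleEquiv.symm
  continuous_toFun := b.continuous_assembleEquiv_symm
  continuous_invFun := b.continuous_assembleUnits.subtype_mk b.assembleUnits_mem

end LowestWeightBases

/-! ### Reindexing isometry groups -/

section Reindex

variable {α β : Type} [Fintype α] [DecidableEq α] [Fintype β] [DecidableEq β]

/-- Reindexing of invertible matrices. -/
def reindexUnits (e : α ≃ β) : (HMat α)ˣ ≃* (HMat β)ˣ :=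
  Units.mapEquiv (Matrix.reindexAlgEquiv ℝ ℍ[ℝ] e).toMulEquiv

theorem reindexUnits_val (e : α ≃ β) (g : (HMat α)ˣ) :
    (reindexUnits e g : HMat β) = (g : HMat α).submatrix e.symm e.symm := rfl

theorem continuous_reindexUnits (e : α ≃ β) : Continuous (reindexUnits e) :=
  continuous_toUnits (reindexUnits e).toMonoidHom
    (Units.continuous_val.matrix_submatrix e.symm e.symm)

theorem reindexUnits_mem (e : α ≃ β) {J : HMat α} {J' : HMat β}
    (hJ : J' = J.submatrix e.symm e.symm) {g : (HMat α)ˣ} (hg : g ∈ quatIsometry J) :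
    reindexUnits e g ∈ quatIsometry J' := by
  have h : (g : HMat α)ᴴ * J * (g : HMat α) = J := hg
  change (reindexUnits e g : HMat β)ᴴ * J' * (reindexUnits e g : HMat β) = J'
  rw [reindexUnits_val, hJ, Matrix.conjTranspose_submatrix, Matrix.submatrix_mul_equiv,
    Matrix.submatrix_mul_equiv, h]

/-- Reindexing identifies isometry groups. -/
def quatIsometryReindex (e : α ≃ β) {J : HMat α} {J' : HMat β}
    (hJ : J' = J.submatrix e.symm e.symm) : quatIsometry J ≃ₜ* quatIsometry J' where
  toFun g := ⟨reindexUnits e g, reindexUnits_mem e hJ g.2⟩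
  invFun g := ⟨reindexUnits e.symm g, reindexUnits_mem e.symm (by rw [hJ]; simp) g.2⟩
  left_inv g := Subtype.ext ((reindexUnits e).symm_apply_apply g)
  right_inv g := Subtype.ext ((reindexUnits e).apply_symm_apply g)
  map_mul' g g' := Subtype.ext (map_mul (reindexUnits e) _ _)
  continuous_toFun := ((continuous_reindexUnits e).comp continuous_subtype_val).subtype_mk _
  continuous_invFun := ((continuous_reindexUnits e.symm).comp continuous_subtype_val).subtype_mk _

end Reindex

end Centralizer

/-! ### Normal forms on the lowest weight spaces and the final assembly -/

section Main

open MulOpposite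

variable {n : ℕ} {X H Y : HMat (Fin n)}

theorem isSkewHermitian_lowestWeightForm (hX : X ∈ soStar n) {d : ℕ} (hd : Odd d) :
    IsSkewHermitian (lowestWeightForm X H Y d) where
  add_right v u w := by
    simp only [lowestWeightForm, Submodule.coe_add, Matrix.mulVec_add, skewForm_add_right]
  smul_right v u a := by
    simp only [lowestWeightForm, Submodule.coe_smul, Matrix.mulVec_smul, skewForm_smul_right]
  star_eq v u := by
    have h : Even (d - 1) := by
      obtain ⟨m, rfl⟩ := hd
      simp
    rw [lowestWeightForm, star_skewForm, skewForm_lie_pow hX, h.neg_one_pow, one_smul,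
      lowestWeightForm]

/-- For v in the radical, X^j v is orthogonal to range X because X^(j+1) v = 0, to L(i) with i ≠ j
by weights, and to L(j) by hypothesis. These span V, so X^j v = 0, and Y^j X^j acts on L(j) by a
nonzero scalar. -/
theorem lowestWeightForm_nondegenerate (hX : X ∈ soStar n) (hH : H ∈ soStar n)
    (r : Sl2Rel X H Y) {d : ℕ} (hd : 1 ≤ d) (v : lowestWeightSpace H Y d)
    (hv : ∀ u, lowestWeightForm X H Y d v u = 0) : v = 0 := by
  have r' := r.map realAction
  obtain ⟨j, rfl⟩ := Nat.exists_eq_add_of_le' hd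
  have hvl := mem_lowestWeightSpace_succ.1 v.2
  have h1 : (X ^ j) *ᵥ (v : Fin n → ℍ[ℝ]) = 0 := by
    refine skewForm_nondegenerate fun z => ?_
    obtain ⟨a, c, ha, rfl⟩ := r'.exists_ker_add_range z
    obtain ⟨N, hN⟩ := r'.exists_sum_lowest
    obtain ⟨f, hf, rfl⟩ := hN a ha
    have h2 := skewForm_lie hX ((X ^ j) *ᵥ (v : Fin n → ℍ[ℝ])) c
    rw [Matrix.mulVec_mulVec, ← pow_succ', X_pow_mulVec_lowest r' v.2 (Nat.lt_succ_self j),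
      skewForm_zero_left, zero_eq_neg] at h2
    rw [skewForm_add_right, realAction_apply, h2, add_zero, skewForm_sum_right]
    refine Finset.sum_eq_zero fun i _ => ?_
    have hfi := mem_lowestWeightSpace_succ.2 (hf i)
    rw [skewForm_lie_pow hX]
    by_cases hi : i = j
    · subst hi
      have := hv ⟨f i, hfi⟩
      rw [lowestWeightForm, Nat.add_sub_cancel] at this
      rw [this, smul_zero]
    · rw [skewForm_lowest_eq_zero hX hH r hd (Nat.le_add_left 1 i) v.2 hfi (by omega), smul_zero]
  obtain ⟨c, hc, h2⟩ := r'.exists_y_pow_x_pow (le_refl j)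
  have h3 := h2 _ hvl
  rw [realAction_pow_apply X, h1, map_zero] at h3
  exact Subtype.ext ((smul_eq_zero.1 h3.symm).resolve_left hc)

/-- Both parities get a basis indexed by `Fin t`, so that the parts form one uniform family. For
even d, p + q = t holds because both sides are the dimension of L(d-1). -/
theorem exists_adapted_basis (hX : X ∈ soStar n) (hH : H ∈ soStar n) (r : Sl2Rel X H Y)
    {d t p q : ℕ} (hd : 1 ≤ d)
    (ht : t = Module.finrank ℍ[ℝ]ᵐᵒᵖ (lowestWeightSpace H Y d))
    (hs : Even d → HasSignature (lowestWeightForm X H Y d) p q) :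
    ∃ b : Module.Basis (Fin t) ℍ[ℝ]ᵐᵒᵖ (lowestWeightSpace H Y d),
      (Odd d → ∀ i k, lowestWeightForm X H Y d (b i) (b k) = skewMatrix t i k) ∧
      (Even d → ∃ e : Fin t ≃ Fin p ⊕ Fin q, ∀ i k,
        lowestWeightForm X H Y d (b i) (b k) = signatureMatrix p q (e i) (e k)) := by
  rcases Nat.even_or_odd d with h | h
  · obtain ⟨b, h1, h2, h3⟩ := hs h
    have hc : Fintype.card (Fin p ⊕ Fin q) = t := by
      rw [ht, Module.finrank_eq_card_basis b]
    let e : Fin t ≃ Fin p ⊕ Fin q := (Fintype.equivFinOfCardEq hc).symm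
    refine ⟨b.reindex e.symm, fun h' => absurd h (Nat.not_even_iff_odd.2 h'), fun _ =>
      ⟨e, fun i k => ?_⟩⟩
    rw [Module.Basis.reindex_apply, Module.Basis.reindex_apply, Equiv.symm_symm, signatureMatrix]
    generalize e i = i'
    generalize e k = k'
    rcases eq_or_ne i' k' with rfl | hne
    · rw [Matrix.diagonal_apply_eq]
      rcases i' with i' | i'
      · exact h2 i'
      · exact h3 i'
    · rw [Matrix.diagonal_apply_ne _ hne, h1 _ _ hne]
  · obtain ⟨b, hb⟩ := (isSkewHermitian_lowestWeightForm hX h).exists_basis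
      (lowestWeightForm_nondegenerate hX hH r hd) ht
    exact ⟨b, fun _ => hb, fun h' => absurd h' (Nat.not_even_iff_odd.2 h)⟩

/-- A product over the parts of a diagram is split into the odd and the even parts. -/
def SignedYoungDiagram.splitParts (D : SignedYoungDiagram n)
    {G : {d // d ∈ D.part.parts.toFinset} → Type} [∀ δ, Group (G δ)] [∀ δ, TopologicalSpace (G δ)]
    {P : D.oddParts → Type} [∀ θ, Group (P θ)] [∀ θ, TopologicalSpace (P θ)]
    {Q : D.evenParts → Type} [∀ η, Group (Q η)] [∀ η, TopologicalSpace (Q η)]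
    (f : ∀ θ : D.oddParts, G ⟨θ, Multiset.mem_toFinset.2 θ.2.1⟩ ≃ₜ* P θ)
    (g : ∀ η : D.evenParts, G ⟨η, Multiset.mem_toFinset.2 η.2.1⟩ ≃ₜ* Q η) :
    (∀ δ, G δ) ≃ₜ* (∀ θ, P θ) × ∀ η, Q η where
  toFun x := (fun θ => f θ (x _), fun η => g η (x _))
  invFun x δ := if h : Odd (δ : ℕ) then (f ⟨δ, Multiset.mem_toFinset.1 δ.2, h⟩).symm (x.1 _)
    else (g ⟨δ, Multiset.mem_toFinset.1 δ.2, Nat.not_odd_iff_even.1 h⟩).symm (x.2 _)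
  left_inv x := by
    funext δ
    by_cases h : Odd (δ : ℕ)
    · simp [h]
    · simp [h]
  right_inv x := by
    refine Prod.ext (funext fun θ => ?_) (funext fun η => ?_)
    · have h : Odd (θ : ℕ) := θ.2.2
      simp [h]
    · have h : ¬ Odd (η : ℕ) := Nat.not_odd_iff_even.2 η.2.2
      simp [h]
  map_mul' x y := by
    refine Prod.ext (funext fun θ => ?_) (funext fun η => ?_)
    · exact map_mul (f θ) _ _
    · exact map_mul (g η) _ _
  continuous_toFun := by
    refine Continuous.prodMk (continuous_pi fun θ => ?_) (continuous_pi fun η => ?_)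
    · exact (f θ).continuous_toFun.comp (continuous_apply _)
    · exact (g η).continuous_toFun.comp (continuous_apply _)
  continuous_invFun := by
    refine continuous_pi fun δ => ?_
    by_cases h : Odd (δ : ℕ)
    · simp only [h, dif_pos]
      exact (f _).continuous_invFun.comp ((continuous_apply _).comp continuous_fst)
    · simp only [h, dif_neg, not_false_eq_true]
      exact (g _).continuous_invFun.comp ((continuous_apply _).comp continuous_snd)

end Main

end

theorem mainTheorem10 (n : ℕ) (X H Y : soStar n) (hX0 : X ≠ 0)
    (hXnil : IsNilpotent (LieAlgebra.ad ℝ (soStar n) X))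
    (hT : IsSl2Triple H X Y)
    (D : SignedYoungDiagram n) (hD : OrbitCorrespondsTo X D) :
    Nonempty
      (adCentralizer (SOStar n)
          {(X : HMat (Fin n)), (H : HMat (Fin n)), (Y : HMat (Fin n))} ≃ₜ*
        ((∀ θ : D.oddParts, SOStar (D.mult θ)) ×
          (∀ η : D.evenParts, SpPQ (D.posCount η) (D.negCount η)))) := by
  obtain ⟨hmult, hsig⟩ := hD.invariants hT
  have r := sl2Rel_of_isSl2Triple hT
  have hpos : ∀ δ : {d // d ∈ D.part.parts.toFinset}, 1 ≤ (δ : ℕ) := fun δ =>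
    D.part.parts_pos (Multiset.mem_toFinset.1 δ.2)
  choose B hodd heven using fun δ : {d // d ∈ D.part.parts.toFinset} =>
    exists_adapted_basis X.2 H.2 r (hpos δ) (hmult δ (hpos δ))
      fun h => hsig δ ⟨Multiset.mem_toFinset.1 δ.2, h⟩
  let b : LowestWeightBases (X : HMat (Fin n)) (H : HMat (Fin n)) (Y : HMat (Fin n))
      {d // d ∈ D.part.parts.toFinset} (fun δ => Fin (D.mult δ)) :=
    { rel := r
      memX := X.2
      memH := H.2
      deg := Subtype.val
      deg_pos := hpos
      deg_injective := Subtype.val_injective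
      basis := B
      -- If d is not a part, its multiplicity, which is the dimension of L(d-1), is 0.
      eq_bot := fun d hd hd' => by
        rw [← Submodule.finrank_eq_zero (R := ℍ[ℝ]ᵐᵒᵖ), ← hmult d hd, SignedYoungDiagram.mult,
          Multiset.count_eq_zero]
        exact fun h => hd' ⟨⟨d, Multiset.mem_toFinset.2 h⟩, rfl⟩
      card_eq := by
        simp only [Fintype.card_fin]
        rw [Finset.sum_coe_sort D.part.parts.toFinset (fun d => D.mult d * d)]
        conv_rhs => rw [← D.part.parts_sum, Finset.sum_multiset_count]
        rfl }
  have hoddGram : ∀ θ : D.oddParts, b.gram ⟨θ, Multiset.mem_toFinset.2 θ.2.1⟩ =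
      skewMatrix (D.mult θ) := fun θ => by
    ext1 i k
    exact hodd ⟨θ, Multiset.mem_toFinset.2 θ.2.1⟩ θ.2.2 i k
  have hevenGram : ∀ η : D.evenParts, ∃ e : Fin (D.mult η) ≃
      Fin (D.posCount η) ⊕ Fin (D.negCount η), signatureMatrix (D.posCount η) (D.negCount η) =
        (b.gram ⟨η, Multiset.mem_toFinset.2 η.2.1⟩).submatrix e.symm e.symm := fun η => by
    obtain ⟨e, he⟩ := heven ⟨η, Multiset.mem_toFinset.2 η.2.1⟩ η.2.2
    refine ⟨e, ?_⟩
    ext1 i k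
    have := he (e.symm i) (e.symm k)
    rw [e.apply_symm_apply, e.apply_symm_apply] at this
    exact this.symm
  choose e he using hevenGram
  -- The odd Gram matrices are already j I; the even ones become I_{p,q} after the reindexing e.
  refine ⟨b.centralizerEquiv.trans (D.splitParts (fun θ => ?_) (fun η => ?_))⟩
  · rw [SOStar_eq]
    exact quatIsometryReindex (Equiv.refl _) (hoddGram θ).symm
  · rw [SpPQ_eq]
    exact quatIsometryReindex (e η) (he η)
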